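/- Let $K_n\times K_2$ denote the $n$-prism, i.e. two disjoint copies of the complete graph $K_n$ together with the perfect matching joining corresponding vertices; the $n$ edges of this matching are called matching edges. By an embedding of a finite connected graph (with at least one edge) we mean a cellular embedding in a closed orientable surface, given combinatorially by its rotation system (for each vertex, a cyclic permutation of the arcs leaving it). Its faces are the closed walks obtained by face tracing, and its genus $g$ is determined by the Euler polyhedral equation $|V|-|E|+|F|=2-2g$. The genus of a graph is the smallest genus of such an embedding. An embedding of $K_n\times K_2$ is called snug if every face incident with a matching edge is quadrangular and every other face is triangular. For every integer $s\ge 1$, with $n=12s+9$, the graph $K_n\times K_2$ has a snug embedding, and its genus is exactly $\frac{(n-2)(n-3)}{6}$ (Ringel's lower bound). -/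

import Mathlib

/-- A rotation system of a simple graph `G`: a permutation of the arcs (darts) of `G` that cyclically
permutes, for each vertex `v`, all the arcs leaving `v`.  Rotation systems are the combinatorial
description of the cellular embeddings of a connected graph in closed oriented surfaces. -/
structure RotationSystem {V : Type*} (G : SimpleGraph V) where
  /-- The arc that follows a given arc in the rotation at its initial vertex. -/
  next : Equiv.Perm G.Dart
  /-- The rotation at `v` only moves arcs leaving `v`. -/
  fst_next : ∀ d : G.Dart, (next d).fst = d.fst
  /-- The arcs leaving `v` form a single cycle. -/
  sameCycle_next : ∀ d e : G.Dart, d.fst = e.fst → next.SameCycle d e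

namespace RotationSystem

variable {V : Type*} {G : SimpleGraph V}

/-- The reversal of arcs, as a permutation. -/
def reverse (G : SimpleGraph V) : Equiv.Perm G.Dart :=
  SimpleGraph.Dart.symm_involutive.toPerm

/-- Face tracing: after the arc `(u, v)`, the boundary walk of the face continues with the arc that
follows `(v, u)` in the rotation at `v`. -/
def faceNext (R : RotationSystem G) : Equiv.Perm G.Dart :=
  (reverse G).trans R.next

/-- The faces of the embedding: the orbits of face tracing. -/
def Face (R : RotationSystem G) : Type _ :=
  Quotient (Equiv.Perm.SameCycle.setoid R.faceNext)

/-- The face whose boundary walk traverses the arc `d`. -/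
def faceOf (R : RotationSystem G) (d : G.Dart) : R.Face :=
  Quotient.mk (Equiv.Perm.SameCycle.setoid R.faceNext) d

/-- The sides of a face: the arcs traversed by its boundary walk. -/
def sides (R : RotationSystem G) (f : R.Face) : Set G.Dart :=
  {d | R.faceOf d = f}

/-- The number of sides of a face, i.e. the length of its boundary walk. -/
noncomputable def length (R : RotationSystem G) (f : R.Face) : ℕ :=
  (R.sides f).ncard

/-- The embedding has genus `g`: the Euler polyhedral equation `|V| - |E| + |F| = 2 - 2g` holds.
(Meaningful for finite connected graphs with at least one edge.) -/
def HasGenus (R : RotationSystem G) (g : ℕ) : Prop :=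
  (Nat.card V : ℤ) - (Nat.card G.edgeSet : ℤ) + (Nat.card R.Face : ℤ) = 2 - 2 * (g : ℤ)

end RotationSystem

/-- `g` is the (minimum) genus of the finite connected graph `G` (with at least one edge): the
smallest `g` such that `G` has a cellular embedding of genus `g`. -/
def IsGraphGenus {V : Type*} (G : SimpleGraph V) (g : ℕ) : Prop :=
  IsLeast {h : ℕ | ∃ R : RotationSystem G, R.HasGenus h} g

/-- The `n`-prism `K_n × K_2`: two copies of `K_n` together with a perfect matching between them. -/
abbrev prism (n : ℕ) : SimpleGraph (Fin n × Fin 2) :=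
  SimpleGraph.boxProd (⊤ : SimpleGraph (Fin n)) (⊤ : SimpleGraph (Fin 2))

/-- An arc of the `n`-prism that runs along a matching edge `(a, 0)(a, 1)`. -/
def IsMatchingDart {n : ℕ} (d : (prism n).Dart) : Prop :=
  d.fst.1 = d.snd.1

/-- An embedding of the `n`-prism is snug if every face incident with a matching edge is
quadrangular and every other face is triangular. -/
def IsSnug {n : ℕ} (R : RotationSystem (prism n)) : Prop :=
  ∀ f : R.Face,
    ((∃ d ∈ R.sides f, IsMatchingDart d) → R.length f = 4) ∧
    ((¬ ∃ d ∈ R.sides f, IsMatchingDart d) → R.length f = 3)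

open Finset

/-! Lower bound. Weigh matching arcs 1 and all other arcs 2; the total weight is 4n² - 2n. In any
embedding each face weighs at least 6: a face that changes copies must change back, and a matching
arc is never followed by another one, so such a face has at least two arcs of each kind; any other
face has at least three arcs of weight 2. Hence 6|F| ≤ 4n² - 2n, and Euler's equation turns this
into g ≥ (n-2)(n-3)/6. Snug embeddings attain equality (`IsSnug.isGraphGenus`), so only a snug
embedding is needed.

From the prism to one complete graph. Suppose K_n is embedded with triangular faces, except for some
faces whose boundaries together pass through each vertex exactly once (`MarkedRotation`). Take this
embedding and its mirror image, delete the exceptional faces and join corresponding boundaries by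
annuli. The matching edges cut the annuli into quadrangles, and the result is snug
(`isSnug_prismRotation`).

Construction. Write s = t + 1, so n = 3(4t+7), and use the vertex set ZMod (4t+7) × Fin 3 with all
faces invariant under translation. Up to translation there are 12t+19 triangles and two marked
faces, one through class 0 and one alternating between classes 1 and 2. All but fifteen triangles
lie in three ladders whose length grows with t. Two facts need checking: every voltage arc occurs on
a face (then it occurs only once, by counting), and the rotation at each class is a single cycle.
`exists_good` proves both together by following the rotation from the mark, with each passage
through a ladder settled by induction. -/

/-- The weight of an arc of the prism: matching arcs weigh `1`, all other arcs weigh `2`. -/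
noncomputable def dartWeight {n : ℕ} (d : (prism n).Dart) : ℕ :=
  open Classical in if IsMatchingDart d then 1 else 2

theorem dartWeight_of_isMatchingDart {n : ℕ} {d : (prism n).Dart} (h : IsMatchingDart d) :
    dartWeight d = 1 := if_pos h

theorem dartWeight_of_not_isMatchingDart {n : ℕ} {d : (prism n).Dart} (h : ¬ IsMatchingDart d) :
    dartWeight d = 2 := if_neg h

/-! ### Coordinates on the arcs of the prism, and the total weight. -/

theorem prism_adj {n : ℕ} {x y : Fin n × Fin 2} :
    (prism n).Adj x y ↔ x.1 ≠ y.1 ∧ x.2 = y.2 ∨ x.2 ≠ y.2 ∧ x.1 = y.1 := by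
  simp [prism, SimpleGraph.boxProd_adj]

theorem Fin.two_add_one_ne (c : Fin 2) : c ≠ c + 1 := by
  revert c; decide

theorem Fin.two_eq_add_one {c e : Fin 2} (h : c ≠ e) : e = c + 1 := by
  revert c e; decide

/-- An arc of the prism is determined by the columns of its ends and the copy of its initial
vertex. -/
def prismDartEquiv (n : ℕ) : (prism n).Dart ≃ (Fin n × Fin n) × Fin 2 where
  toFun d := ((d.fst.1, d.snd.1), d.fst.2)
  invFun p := if h : p.1.1 = p.1.2 then
      ⟨((p.1.1, p.2), (p.1.2, p.2 + 1)), prism_adj.2 (Or.inr ⟨Fin.two_add_one_ne _, h⟩)⟩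
    else ⟨((p.1.1, p.2), (p.1.2, p.2)), prism_adj.2 (Or.inl ⟨h, rfl⟩)⟩
  left_inv d := by
    obtain ⟨⟨⟨a, c⟩, ⟨b, e⟩⟩, h⟩ := d
    rcases prism_adj.1 h with ⟨h1, h2⟩ | ⟨h1, h2⟩
    · simp only at h1 h2
      subst h2
      simp [h1]
    · simp only at h1 h2
      have := Fin.two_eq_add_one h1
      subst h2 this
      simp
  right_inv p := by
    obtain ⟨⟨a, b⟩, c⟩ := p
    by_cases h : a = b <;> simp [h]

theorem isMatchingDart_iff {n : ℕ} (d : (prism n).Dart) :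
    IsMatchingDart d ↔ (prismDartEquiv n d).1.1 = (prismDartEquiv n d).1.2 := Iff.rfl

theorem prismDartEquiv_symm {n : ℕ} (d : (prism n).Dart) :
    prismDartEquiv n d.symm =
      (((prismDartEquiv n d).1.2, (prismDartEquiv n d).1.1),
        if (prismDartEquiv n d).1.1 = (prismDartEquiv n d).1.2
          then (prismDartEquiv n d).2 + 1 else (prismDartEquiv n d).2) := by
  obtain ⟨⟨⟨a, c⟩, ⟨b, e⟩⟩, h⟩ := d
  rcases prism_adj.1 h with ⟨h1, h2⟩ | ⟨h1, h2⟩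
  · simp only at h1 h2
    subst h2
    simp [h1, prismDartEquiv, SimpleGraph.Dart.symm]
  · simp only at h1 h2
    have := Fin.two_eq_add_one h1
    subst h2 this
    simp [prismDartEquiv, SimpleGraph.Dart.symm]

instance (n : ℕ) : DecidableRel (prism n).Adj := fun _ _ => decidable_of_iff' _ prism_adj

theorem card_prism_dart (n : ℕ) : Fintype.card (prism n).Dart = 2 * n ^ 2 := by
  rw [Fintype.card_congr (prismDartEquiv n)]
  simp
  ring

theorem card_prism_edgeSet (n : ℕ) : Nat.card (prism n).edgeSet = n ^ 2 := by
  have h1 := (prism n).dart_card_eq_twice_card_edges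
  rw [card_prism_dart] at h1
  rw [Nat.card_eq_fintype_card, ← SimpleGraph.edgeFinset_card]
  omega

/-- There are 2n² arcs, of which 2n are matching arcs and fall short of weight 2 by one each. The
deficit stands on the left to avoid natural subtraction. -/
theorem sum_dartWeight (n : ℕ) : (∑ d : (prism n).Dart, dartWeight d) + 2 * n = 4 * n ^ 2 := by
  classical
  have h : ∑ d : (prism n).Dart, dartWeight d
      = ∑ p : (Fin n × Fin n) × Fin 2, if p.1.1 = p.1.2 then 1 else 2 :=
    Fintype.sum_equiv (prismDartEquiv n) _ _ fun d => by
      simp only [dartWeight, isMatchingDart_iff]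
  have h2 : ∀ a b : Fin n, (if a = b then 1 else 2) + (if a = b then 1 else 0) = 2 := by
    intro a b; split_ifs <;> rfl
  have h3 : (∑ p : (Fin n × Fin n) × Fin 2, if p.1.1 = p.1.2 then 1 else 2)
      + (∑ p : (Fin n × Fin n) × Fin 2, if p.1.1 = p.1.2 then 1 else 0) = 4 * n ^ 2 := by
    rw [← Finset.sum_add_distrib]
    simp only [h2]
    simp
    ring
  have h4 : (∑ p : (Fin n × Fin n) × Fin 2, if p.1.1 = p.1.2 then 1 else 0) = 2 * n := by
    rw [Fintype.sum_prod_type_right]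
    simp only [Fintype.sum_prod_type]
    simp
  omega

/-! ### Ringel's lower bound by weighing faces. -/

namespace RotationSystem

variable {V : Type*} {G : SimpleGraph V}

theorem faceNext_apply (R : RotationSystem G) (d : G.Dart) : R.faceNext d = R.next d.symm := rfl

theorem faceOf_eq_iff (R : RotationSystem G) {d e : G.Dart} :
    R.faceOf d = R.faceOf e ↔ R.faceNext.SameCycle d e := Quotient.eq (r := Equiv.Perm.SameCycle.setoid R.faceNext)

theorem fst_faceNext (R : RotationSystem G) (d : G.Dart) : (R.faceNext d).fst = d.snd := by
  rw [faceNext_apply, R.fst_next]; rfl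

theorem faceOf_faceNext (R : RotationSystem G) (d : G.Dart) :
    R.faceOf (R.faceNext d) = R.faceOf d :=
  R.faceOf_eq_iff.2 (Equiv.Perm.SameCycle.refl _ _).apply_left

theorem faceNext_ne (R : RotationSystem G) (d : G.Dart) : R.faceNext d ≠ d := fun h =>
  d.fst_ne_snd (by rw [← R.fst_faceNext d, h])

/-- At a vertex with at least two arcs the rotation fixes no arc. -/
theorem next_ne (R : RotationSystem G) {d e : G.Dart} (hde : d ≠ e) (hf : d.fst = e.fst) :
    R.next d ≠ d := by
  intro h
  obtain ⟨k, hk⟩ := R.sameCycle_next d e hf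
  exact hde ((Equiv.Perm.zpow_apply_eq_self_of_apply_eq_self h k).symm.trans hk)

end RotationSystem

theorem IsMatchingDart.snd_ne {n : ℕ} {d : (prism n).Dart} (h : IsMatchingDart d) :
    d.snd.2 ≠ d.fst.2 := fun h' => d.fst_ne_snd (Prod.ext h h'.symm)

theorem snd_eq_of_not_isMatchingDart {n : ℕ} {d : (prism n).Dart} (h : ¬ IsMatchingDart d) :
    d.snd.2 = d.fst.2 := by
  rcases prism_adj.1 d.adj with h' | h'
  · exact h'.2.symm
  · exact absurd h'.2 h

theorem IsMatchingDart.eq_symm {n : ℕ} {d e : (prism n).Dart} (hd : IsMatchingDart d)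
    (he : IsMatchingDart e) (h : e.fst = d.snd) : e = d.symm := by
  refine SimpleGraph.Dart.ext _ _ (Prod.ext h (Prod.ext ?_ ?_))
  · change e.snd.1 = d.fst.1
    exact he.symm.trans ((congrArg Prod.fst h).trans hd.symm)
  · change e.snd.2 = d.fst.2
    have h1 := Fin.two_eq_add_one he.snd_ne.symm
    have h2 := Fin.two_eq_add_one hd.snd_ne
    rw [h1, h, h2]

theorem exists_dart_ne {n : ℕ} (hn : 2 ≤ n) (d : (prism n).Dart) :
    ∃ e : (prism n).Dart, d ≠ e ∧ d.fst = e.fst := by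
  by_cases hd : IsMatchingDart d
  · have : Nontrivial (Fin n) := Fin.nontrivial_iff_two_le.2 hn
    obtain ⟨b, hb⟩ := exists_ne d.fst.1
    refine ⟨⟨(d.fst, (b, d.fst.2)), prism_adj.2 (Or.inl ⟨hb.symm, rfl⟩)⟩, ?_, rfl⟩
    intro h
    have := congrArg (fun e : (prism n).Dart => e.snd.2) h
    exact hd.snd_ne this
  · refine ⟨⟨(d.fst, (d.fst.1, d.fst.2 + 1)),
      prism_adj.2 (Or.inr ⟨Fin.two_add_one_ne _, rfl⟩)⟩, ?_, rfl⟩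
    intro h
    have := congrArg (fun e : (prism n).Dart => e.snd.2) h
    exact Fin.two_add_one_ne _ ((snd_eq_of_not_isMatchingDart hd).symm.trans this)

namespace RotationSystem

variable {n : ℕ}

/-- A face could turn straight back only at a vertex of degree 1. This rules out faces with fewer
than three sides and consecutive matching arcs. -/
theorem faceNext_ne_symm (hn : 2 ≤ n) (R : RotationSystem (prism n)) (d : (prism n).Dart) :
    R.faceNext d ≠ d.symm := by
  obtain ⟨e, he, hf⟩ := exists_dart_ne hn d.symm
  exact R.next_ne he hf

theorem faceNext_faceNext_ne (hn : 2 ≤ n) (R : RotationSystem (prism n)) (d : (prism n).Dart) :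
    R.faceNext (R.faceNext d) ≠ d := by
  intro h
  refine R.faceNext_ne_symm hn d (SimpleGraph.Dart.ext _ _ (Prod.ext (R.fst_faceNext d) ?_))
  have := R.fst_faceNext (R.faceNext d)
  rw [h] at this
  exact this.symm

theorem not_isMatchingDart_faceNext (hn : 2 ≤ n) (R : RotationSystem (prism n))
    {d : (prism n).Dart} (hd : IsMatchingDart d) : ¬ IsMatchingDart (R.faceNext d) := fun h =>
  R.faceNext_ne_symm hn d (hd.eq_symm h (R.fst_faceNext d))

/-- A face that passes from one copy to the other has to return. -/
theorem exists_isMatchingDart_fst_ne (R : RotationSystem (prism n)) {d : (prism n).Dart}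
    (hd : IsMatchingDart d) :
    ∃ e, R.faceOf e = R.faceOf d ∧ IsMatchingDart e ∧ e.fst.2 ≠ d.fst.2 := by
  by_contra! hcon
  have hface : ∀ k : ℕ, R.faceOf ((R.faceNext ^ k) d) = R.faceOf d := fun k =>
    R.faceOf_eq_iff.2 (Equiv.Perm.SameCycle.symm ⟨k, by simp⟩)
  -- If no matching arc of the face leads back, the walk stays in the other copy forever after `d`,
  -- which contradicts its periodicity.
  have key : ∀ k : ℕ, ((R.faceNext ^ (k + 1)) d).fst.2 ≠ d.fst.2 := by
    intro k
    induction k with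
    | zero =>
      rw [zero_add, pow_one, R.fst_faceNext]
      exact hd.snd_ne
    | succ k ih =>
      rw [pow_succ', Equiv.Perm.mul_apply, R.fst_faceNext]
      by_cases hm : IsMatchingDart ((R.faceNext ^ (k + 1)) d)
      · exact absurd (hcon _ (hface _) hm) ih
      · rwa [snd_eq_of_not_isMatchingDart hm]
  have hpos := orderOf_pos R.faceNext
  refine key (orderOf R.faceNext - 1) ?_
  rw [Nat.sub_add_cancel hpos, pow_orderOf_eq_one, Equiv.Perm.one_apply]

/-- Every face has sides of total weight `6`; these are four sides if the face is incident with a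
matching edge, and three otherwise. -/
theorem exists_sides_dartWeight (hn : 2 ≤ n) (R : RotationSystem (prism n)) (f : R.Face) :
    ∃ S : Finset (prism n).Dart, (∀ d ∈ S, R.faceOf d = f) ∧ ∑ d ∈ S, dartWeight d = 6 ∧
      ((∃ d ∈ R.sides f, IsMatchingDart d) ∧ #S = 4 ∨
        (¬ ∃ d ∈ R.sides f, IsMatchingDart d) ∧ #S = 3) := by
  classical
  by_cases hf : ∃ d ∈ R.sides f, IsMatchingDart d
  · obtain ⟨d, hdf, hd⟩ := hf
    obtain ⟨e, hef, he, hde⟩ := R.exists_isMatchingDart_fst_ne hd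
    have hd' := R.not_isMatchingDart_faceNext hn hd
    have he' := R.not_isMatchingDart_faceNext hn he
    have h1 : d ≠ e := fun h => hde (by rw [h])
    have h2 : d ≠ R.faceNext d := (R.faceNext_ne d).symm
    have h3 : d ≠ R.faceNext e := fun h => he' (h ▸ hd)
    have h4 : e ≠ R.faceNext d := fun h => hd' (h ▸ he)
    have h5 : e ≠ R.faceNext e := (R.faceNext_ne e).symm
    have h6 : R.faceNext d ≠ R.faceNext e := fun h => h1 (R.faceNext.injective h)
    -- Two matching arcs that start in different copies, and their successors, which are not
    -- matching arcs: 1 + 1 + 2 + 2 = 6.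
    refine ⟨{d, e, R.faceNext d, R.faceNext e}, ?_, ?_, Or.inl ⟨⟨d, hdf, hd⟩, ?_⟩⟩
    · intro x hx
      simp only [mem_insert, mem_singleton] at hx
      rcases hx with rfl | rfl | rfl | rfl
      · exact hdf
      · exact hef.trans hdf
      · exact (R.faceOf_faceNext _).trans hdf
      · exact (R.faceOf_faceNext _).trans (hef.trans hdf)
    · rw [sum_insert (by simp [h1, h2, h3]), sum_insert (by simp [h4, h5]),
        sum_insert (by simp [h6]), sum_singleton, dartWeight_of_isMatchingDart hd,
        dartWeight_of_isMatchingDart he, dartWeight_of_not_isMatchingDart hd',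
        dartWeight_of_not_isMatchingDart he']
      rfl
    · rw [card_insert_of_notMem (by simp [h1, h2, h3]), card_insert_of_notMem (by simp [h4, h5]),
        card_insert_of_notMem (by simp [h6]), card_singleton]
  · obtain ⟨d, rfl⟩ : ∃ d, R.faceOf d = f := Quotient.exists_rep f
    have hw : ∀ x, R.faceOf x = R.faceOf d → dartWeight x = 2 := fun x hx =>
      dartWeight_of_not_isMatchingDart fun h => hf ⟨x, hx, h⟩
    have h1 : d ≠ R.faceNext d := (R.faceNext_ne d).symm
    have h2 : d ≠ R.faceNext (R.faceNext d) := (R.faceNext_faceNext_ne hn d).symm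
    have h3 : R.faceNext d ≠ R.faceNext (R.faceNext d) := (R.faceNext_ne _).symm
    have hS : ∀ x ∈ ({d, R.faceNext d, R.faceNext (R.faceNext d)} : Finset (prism n).Dart),
        R.faceOf x = R.faceOf d := by
      intro x hx
      simp only [mem_insert, mem_singleton] at hx
      rcases hx with rfl | rfl | rfl
      · rfl
      · exact R.faceOf_faceNext _
      · exact (R.faceOf_faceNext _).trans (R.faceOf_faceNext _)
    have hc : #({d, R.faceNext d, R.faceNext (R.faceNext d)} : Finset (prism n).Dart) = 3 := by
      rw [card_insert_of_notMem (by simp [h1, h2]), card_insert_of_notMem (by simp [h3]),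
        card_singleton]
    refine ⟨_, hS, ?_, Or.inr ⟨hf, hc⟩⟩
    rw [sum_congr rfl fun x hx => hw x (hS x hx), sum_const, hc, smul_eq_mul]

noncomputable instance (R : RotationSystem (prism n)) : Fintype R.Face := by
  classical
  exact Fintype.ofSurjective R.faceOf Quotient.exists_rep

theorem sum_faces_dartWeight (R : RotationSystem (prism n)) [DecidableEq R.Face] :
    ∑ f : R.Face, ∑ d with R.faceOf d = f, dartWeight d = ∑ d : (prism n).Dart, dartWeight d :=
  sum_fiberwise _ _ _

theorem card_face_le (hn : 2 ≤ n) (R : RotationSystem (prism n)) :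
    6 * Nat.card R.Face + 2 * n ≤ 4 * n ^ 2 := by
  classical
  rw [← sum_dartWeight n, ← R.sum_faces_dartWeight, Nat.card_eq_fintype_card, mul_comm]
  refine Nat.add_le_add_right ?_ _
  rw [← smul_eq_mul, ← Finset.card_univ]
  refine Finset.card_nsmul_le_sum _ _ _ fun f _ => ?_
  obtain ⟨S, hS, hw, -⟩ := R.exists_sides_dartWeight hn f
  rw [← hw]
  exact sum_le_sum_of_subset fun d hd => by simpa using hS d hd

/-- In a snug embedding the sides of weight 6 already number as many as the length of the face, so
they are all of its sides and the weight is exactly 6. -/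
theorem _root_.IsSnug.card_face (hn : 2 ≤ n) {R : RotationSystem (prism n)} (hR : IsSnug R) :
    6 * Nat.card R.Face + 2 * n = 4 * n ^ 2 := by
  classical
  rw [← sum_dartWeight n, ← R.sum_faces_dartWeight, Nat.card_eq_fintype_card, mul_comm]
  congr 1
  rw [← smul_eq_mul, ← Finset.card_univ, ← Finset.sum_const]
  refine Finset.sum_congr rfl fun f _ => ?_
  obtain ⟨S, hS, hw, hc⟩ := R.exists_sides_dartWeight hn f
  have hlen : R.length f = #S := by
    rcases hc with ⟨h, hc⟩ | ⟨h, hc⟩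
    · rw [hc, (hR f).1 h]
    · rw [hc, (hR f).2 h]
  have hfilter : R.length f = #{d | R.faceOf d = f} := by
    rw [length, sides, Set.ncard_eq_toFinset_card']
    congr 1
    ext
    simp
  rw [← hw]
  refine congrArg (fun T => ∑ d ∈ T, dartWeight d) (Finset.eq_of_subset_of_card_le ?_ ?_)
  · intro d hd
    simpa using hS d hd
  · rw [← hfilter, hlen]

theorem hasGenus_iff (R : RotationSystem (prism n)) (g : ℕ) :
    R.HasGenus g ↔ 2 * (n : ℤ) - (n : ℤ) ^ 2 + (Nat.card R.Face : ℤ) = 2 - 2 * (g : ℤ) := by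
  rw [HasGenus, card_prism_edgeSet, Nat.card_eq_fintype_card]
  simp [mul_comm]

end RotationSystem

/-- A snug embedding of the prism realizes Ringel's lower bound for the genus. -/
theorem IsSnug.isGraphGenus {n g : ℕ} (hn : 2 ≤ n) {R : RotationSystem (prism n)} (hR : IsSnug R)
    (hg : 6 * (g : ℤ) = ((n : ℤ) - 2) * ((n : ℤ) - 3)) : IsGraphGenus (prism n) g := by
  constructor
  · refine ⟨R, (R.hasGenus_iff g).2 ?_⟩
    have h := hR.card_face hn
    zify at h
    linarith
  · rintro k ⟨R', hk⟩
    rw [R'.hasGenus_iff] at hk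
    have h := R'.card_face_le hn
    zify at h ⊢
    linarith

/-! ### Marked rotations of complete graphs. -/

/-- A rotation of the complete graph on `V` with one marked corner at every vertex: for every `a`
the pairs `(a, b)` are permuted cyclically, where `(a, b)` with `a ≠ b` is an arc, and `(a, a)` is
the mark.  If the marks are ignored, all faces are triangles, except that the marked corners are
precisely the corners of the remaining faces. -/
structure MarkedRotation (V : Type*) where
  /-- The arc or mark that follows a given one. -/
  next : Equiv.Perm (V × V)
  fst_next : ∀ p, (next p).1 = p.1
  sameCycle_next : ∀ a b c, next.SameCycle (a, b) (a, c)
  triangle : ∀ a b c, a ≠ b → c ≠ b → next (b, a) = (b, c) → next (c, b) = (c, a)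
  marked : ∀ a b, a ≠ b → next (b, a) = (b, b) → next (a, a) = (a, b)

namespace MarkedRotation

/-- Transport of a marked rotation along a bijection of the vertices. -/
def map {V W : Type*} (P : MarkedRotation V) (e : V ≃ W) : MarkedRotation W where
  next := (e.prodCongr e).permCongr P.next
  fst_next p := by
    simp [Equiv.permCongr_apply, P.fst_next]
  sameCycle_next a b c := by
    obtain ⟨k, hk⟩ := P.sameCycle_next (e.symm a) (e.symm b) (e.symm c)
    refine ⟨k, ?_⟩
    have : (e.prodCongr e).permCongr P.next ^ k = (e.prodCongr e).permCongr (P.next ^ k) :=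
      (map_zpow (e.prodCongr e).permCongrHom P.next k).symm
    rw [this]
    simp [Equiv.permCongr_apply, hk]
  triangle a b c hab hcb h := by
    have h1 : P.next (e.symm b, e.symm a) = (e.symm b, e.symm c) := by
      rw [Equiv.permCongr_apply, ← Equiv.eq_symm_apply] at h
      simpa using h
    have h2 := P.triangle _ _ _ (e.symm.injective.ne hab) (e.symm.injective.ne hcb) h1
    simp [Equiv.permCongr_apply, h2]
  marked a b hab h := by
    have h1 : P.next (e.symm b, e.symm a) = (e.symm b, e.symm b) := by
      rw [Equiv.permCongr_apply, ← Equiv.eq_symm_apply] at h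
      simpa using h
    have h2 := P.marked _ _ (e.symm.injective.ne hab) h1
    simp [Equiv.permCongr_apply, h2]

section General

variable {V : Type*} (P : MarkedRotation V)

theorem next_ne [Nontrivial V] (p : V × V) : P.next p ≠ p := by
  obtain ⟨a, b⟩ := p
  intro h
  obtain ⟨c, hc⟩ := exists_ne b
  obtain ⟨k, hk⟩ := P.sameCycle_next a b c
  rw [Equiv.Perm.zpow_apply_eq_self_of_apply_eq_self h k] at hk
  exact hc (congrArg Prod.snd hk).symm

theorem exists_next (a b : V) : ∃ c, P.next (a, b) = (a, c) :=
  ⟨(P.next (a, b)).2, Prod.ext (P.fst_next _) rfl⟩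

theorem exists_next_eq (a b : V) : ∃ c, P.next (a, c) = (a, b) := by
  refine ⟨(P.next.symm (a, b)).2, ?_⟩
  have h := P.fst_next (P.next.symm (a, b))
  rw [Equiv.apply_symm_apply] at h
  rw [← Equiv.eq_symm_apply]
  exact Prod.ext h rfl

/-- Whenever the mark at `a` is followed by `(a, b)`, it is preceded at `b` by `(b, a)`. -/
theorem marked_symm [Finite V] [Nontrivial V] {a b : V} (h : P.next (a, a) = (a, b)) :
    P.next (b, a) = (b, b) := by
  choose p hp using fun a => P.exists_next_eq a a
  have hne : ∀ a, p a ≠ a := fun a h => P.next_ne (a, a) (by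
    have := hp a
    rwa [h] at this)
  have hpp : ∀ a, P.next (p a, p a) = (p a, a) := fun a => P.marked _ _ (hne a) (hp a)
  -- `p a` is the predecessor of the mark at `a`. By the axiom `marked`, `a` can be recovered as the
  -- successor of the mark at `p a`. Finiteness makes `p` surjective, which yields the converse of
  -- `marked`.
  have hinj : Function.Injective p := by
    intro a b hab
    have h1 := hpp a
    rw [hab, hpp b] at h1
    exact (congrArg Prod.snd h1).symm
  obtain ⟨c, rfl⟩ := Finite.surjective_of_injective hinj a
  rw [hpp] at h
  obtain rfl : c = b := congrArg Prod.snd h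
  exact hp c

theorem triangle_symm [Nontrivial V] {a b c : V} (hab : a ≠ b) (hcb : c ≠ b)
    (h : P.next (b, a) = (b, c)) : P.next (a, c) = (a, b) := by
  have hca : c ≠ a := fun h' => P.next_ne (b, a) (by rw [h, h'])
  exact P.triangle b c a hcb.symm hca.symm (P.triangle a b c hab hcb h)

end General

/-! ### From a marked rotation to a snug embedding of the prism. -/

variable {n : ℕ} (P : MarkedRotation (Fin n))

/-- The rotation of the prism on a pair of columns together with the copy of the initial vertex:
the rotation is reversed in the second copy. -/
def prismNext : Equiv.Perm ((Fin n × Fin n) × Fin 2) :=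
  Equiv.prodCongrLeft fun c : Fin 2 => if c = 0 then P.next else P.next⁻¹

theorem prismNext_zero (p : Fin n × Fin n) : P.prismNext (p, 0) = (P.next p, 0) := rfl

theorem prismNext_one (p : Fin n × Fin n) : P.prismNext (p, 1) = (P.next⁻¹ p, 1) := rfl

theorem prismNext_zpow (k : ℤ) (p : Fin n × Fin n) (c : Fin 2) :
    (P.prismNext ^ k) (p, c) = (((if c = 0 then P.next else P.next⁻¹) ^ k) p, c) := by
  have hpow : ∀ (k : ℕ) (p : Fin n × Fin n),
      (P.prismNext ^ k) (p, c) = (((if c = 0 then P.next else P.next⁻¹) ^ k) p, c) := by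
    intro k
    induction k with
    | zero => intro p; rfl
    | succ k ih =>
      intro p
      rw [pow_succ, Equiv.Perm.mul_apply, pow_succ, Equiv.Perm.mul_apply]
      exact ih _
  obtain ⟨k, rfl | rfl⟩ := k.eq_nat_or_neg
  · exact_mod_cast hpow k p
  · rw [zpow_neg, zpow_neg, zpow_natCast, zpow_natCast, Equiv.Perm.inv_eq_iff_eq, hpow]
    exact Prod.ext (Equiv.apply_symm_apply _ _).symm rfl

/-- The embedding of the prism that consists of a marked rotation and its mirror image, joined by
the matching edges at the marked corners. -/
def prismRotation : RotationSystem (prism n) where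
  next := (prismDartEquiv n).symm.permCongr P.prismNext
  fst_next d := by
    have h : ∀ x : (Fin n × Fin n) × Fin 2, ((prismDartEquiv n).symm x).fst = (x.1.1, x.2) := by
      intro x
      obtain ⟨d, rfl⟩ := (prismDartEquiv n).surjective x
      rw [Equiv.symm_apply_apply]
      rfl
    have h' : ∀ x : (Fin n × Fin n) × Fin 2,
        (P.prismNext x).1.1 = x.1.1 ∧ (P.prismNext x).2 = x.2 := by
      rintro ⟨⟨a, b⟩, c⟩
      refine ⟨?_, rfl⟩
      fin_cases c
      · exact P.fst_next _
      · have := P.fst_next (P.next.symm (a, b))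
        rw [Equiv.apply_symm_apply] at this
        exact this.symm
    rw [Equiv.permCongr_apply, Equiv.symm_symm, h, (h' _).1, (h' _).2]
    rfl
  sameCycle_next d e h := by
    obtain ⟨k, hk⟩ : P.prismNext.SameCycle (prismDartEquiv n d) (prismDartEquiv n e) := by
      have h1 : (prismDartEquiv n d).1.1 = (prismDartEquiv n e).1.1 :=
        congrArg (fun x : Fin n × Fin 2 => x.1) h
      have h2 : (prismDartEquiv n d).2 = (prismDartEquiv n e).2 :=
        congrArg (fun x : Fin n × Fin 2 => x.2) h
      generalize prismDartEquiv n d = x at *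
      generalize prismDartEquiv n e = y at *
      obtain ⟨⟨a, b⟩, c⟩ := x
      obtain ⟨⟨a', b'⟩, c'⟩ := y
      simp only at h1 h2
      subst h1 h2
      have : (if c = 0 then P.next else P.next⁻¹).SameCycle (a, b) (a, b') := by
        split_ifs
        · exact P.sameCycle_next a b b'
        · exact (P.sameCycle_next a b b').inv
      obtain ⟨k, hk⟩ := this
      exact ⟨k, by rw [prismNext_zpow, hk]⟩
    refine ⟨k, ?_⟩
    have : (prismDartEquiv n).symm.permCongr P.prismNext ^ k
        = (prismDartEquiv n).symm.permCongr (P.prismNext ^ k) :=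
      (map_zpow (prismDartEquiv n).symm.permCongrHom P.prismNext k).symm
    rw [this, Equiv.permCongr_apply, Equiv.symm_symm, hk, Equiv.symm_apply_apply]

/-- Face tracing in coordinates. -/
def prismFace (x : (Fin n × Fin n) × Fin 2) : (Fin n × Fin n) × Fin 2 :=
  P.prismNext ((x.1.2, x.1.1), if x.1.1 = x.1.2 then x.2 + 1 else x.2)

theorem prismDartEquiv_faceNext (d : (prism n).Dart) :
    prismDartEquiv n (P.prismRotation.faceNext d) = P.prismFace (prismDartEquiv n d) := by
  rw [RotationSystem.faceNext_apply]
  change prismDartEquiv n ((prismDartEquiv n).symm.permCongr P.prismNext d.symm) = _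
  rw [Equiv.permCongr_apply, Equiv.symm_symm, Equiv.apply_symm_apply, prismDartEquiv_symm,
    prismFace]

theorem prismFace_zero {a b c : Fin n} (hab : a ≠ b) (h : P.next (b, a) = (b, c)) :
    P.prismFace ((a, b), 0) = ((b, c), 0) := by
  simp [prismFace, hab, prismNext_zero, h]

theorem prismFace_one {a b c : Fin n} (hab : a ≠ b) (h : P.next (b, c) = (b, a)) :
    P.prismFace ((a, b), 1) = ((b, c), 1) := by
  simp [prismFace, hab, prismNext_one, ← h]

theorem prismFace_mark_zero {a c : Fin n} (h : P.next (a, c) = (a, a)) :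
    P.prismFace ((a, a), 0) = ((a, c), 1) := by
  simp [prismFace, prismNext_one, ← h]

theorem prismFace_mark_one {a c : Fin n} (h : P.next (a, a) = (a, c)) :
    P.prismFace ((a, a), 1) = ((a, c), 0) := by
  have : (1 : Fin 2) + 1 = 0 := rfl
  simp [prismFace, prismNext_zero, h, this]

end MarkedRotation

namespace RotationSystem

variable {V : Type*} {G : SimpleGraph V} [Finite G.Dart] (R : RotationSystem G)

/-- The first `k` iterates exhaust the orbit; `k` need not be the least period. -/
theorem length_faceOf_le {d : G.Dart} {k : ℕ} (hk : 0 < k) (h : (R.faceNext ^ k) d = d) :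
    R.length (R.faceOf d) ≤ k := by
  classical
  have hsub : R.sides (R.faceOf d) ⊆ ((range k).image fun i => (R.faceNext ^ i) d : Finset _) := by
    intro e he
    have he' : R.faceOf d = R.faceOf e := Eq.symm he
    obtain ⟨i, -, hi⟩ := (R.faceOf_eq_iff.1 he').exists_pow_eq'
    simp only [coe_image, coe_range, Set.mem_image, Set.mem_Iio]
    refine ⟨i % k, Nat.mod_lt _ hk, ?_⟩
    rw [← hi]
    conv_rhs => rw [← Nat.mod_add_div i k, pow_add, pow_mul, Equiv.Perm.mul_apply]
    rw [Equiv.Perm.pow_apply_eq_self_of_apply_eq_self h]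
  calc R.length (R.faceOf d) ≤ _ := Set.ncard_le_ncard hsub (Finset.finite_toSet _)
    _ ≤ k := by
      rw [Set.ncard_coe_finset]
      exact card_image_le.trans (card_range k).le

end RotationSystem

namespace MarkedRotation

variable {n : ℕ} (P : MarkedRotation (Fin n))

theorem prismDartEquiv_faceNext_pow (k : ℕ) (d : (prism n).Dart) :
    prismDartEquiv n ((P.prismRotation.faceNext ^ k) d) = P.prismFace^[k] (prismDartEquiv n d) := by
  induction k with
  | zero => rfl
  | succ k ih =>
    rw [pow_succ', Equiv.Perm.mul_apply, prismDartEquiv_faceNext, ih,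
      Function.iterate_succ_apply']

/-- The quadrangle crosses at `a`, runs in the other copy to a neighbour of `a` along the marked
face, crosses back there and returns along the same edge of the first copy. -/
theorem iterate_prismFace_mark [Nontrivial (Fin n)] (a : Fin n) (c : Fin 2) :
    P.prismFace^[4] ((a, a), c) = ((a, a), c) := by
  obtain rfl | rfl : c = 0 ∨ c = 1 := by omega
  · obtain ⟨e, he⟩ := P.exists_next_eq a a
    have hea : e ≠ a := fun h => P.next_ne (a, a) (by rwa [h] at he)
    have h2 := P.marked e a hea he
    rw [Function.iterate_succ_apply, P.prismFace_mark_zero he, Function.iterate_succ_apply, P.prismFace_one hea.symm h2, Function.iterate_succ_apply, P.prismFace_mark_one h2, Function.iterate_succ_apply, P.prismFace_zero hea he, Function.iterate_zero_apply]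
  · obtain ⟨b, hb⟩ := P.exists_next a a
    have hba : b ≠ a := fun h => P.next_ne (a, a) (by rwa [h] at hb)
    have h2 := P.marked_symm hb
    rw [Function.iterate_succ_apply, P.prismFace_mark_one hb, Function.iterate_succ_apply, P.prismFace_zero hba.symm h2, Function.iterate_succ_apply, P.prismFace_mark_zero h2, Function.iterate_succ_apply, P.prismFace_one hba hb, Function.iterate_zero_apply]

/-- In the second copy the rotation is inverted, so the same triangles are traced in the opposite
direction. -/
theorem iterate_prismFace_triangle [Nontrivial (Fin n)] {a b : Fin n} (c : Fin 2) (hab : a ≠ b)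
    (h : (P.prismFace ((a, b), c)).1.1 ≠ (P.prismFace ((a, b), c)).1.2) :
    P.prismFace^[3] ((a, b), c) = ((a, b), c) := by
  obtain rfl | rfl : c = 0 ∨ c = 1 := by omega
  · obtain ⟨e, he⟩ := P.exists_next b a
    rw [P.prismFace_zero hab he] at h
    have h2 := P.triangle a b e hab h.symm he
    have h3 := P.triangle_symm hab h.symm he
    have hea : e ≠ a := fun h' => P.next_ne (b, a) (by rw [he, h'])
    rw [Function.iterate_succ_apply, P.prismFace_zero hab he, Function.iterate_succ_apply, P.prismFace_zero h h2, Function.iterate_succ_apply, P.prismFace_zero hea h3, Function.iterate_zero_apply]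
  · obtain ⟨e, he⟩ := P.exists_next_eq b a
    rw [P.prismFace_one hab he] at h
    have hea : e ≠ a := fun h' => P.next_ne (b, a) (by rwa [h'] at he)
    have h2 := P.triangle e b a h.symm hab he
    have h3 := P.triangle_symm h.symm hab he
    rw [Function.iterate_succ_apply, P.prismFace_one hab he, Function.iterate_succ_apply, P.prismFace_one h h3, Function.iterate_succ_apply, P.prismFace_one hea h2, Function.iterate_zero_apply]

/-- Face tracing returns after four or three steps, which bounds the lengths above; the sides used
for Ringel's bound give the matching lower estimate. -/
theorem isSnug_prismRotation (hn : 2 ≤ n) : IsSnug P.prismRotation := by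
  have : Nontrivial (Fin n) := Fin.nontrivial_iff_two_le.2 hn
  intro f
  obtain ⟨S, hS, -, hc⟩ := P.prismRotation.exists_sides_dartWeight hn f
  have hle : #S ≤ P.prismRotation.length f := by
    rw [RotationSystem.length, ← Set.ncard_coe_finset]
    exact Set.ncard_le_ncard (fun d hd => hS d hd) (Set.toFinite _)
  refine ⟨fun hf => ?_, fun hf => ?_⟩
  · obtain ⟨d, rfl, hd⟩ := id hf
    replace hc : #S = 4 := (hc.resolve_right fun h => h.1 hf).2
    refine le_antisymm (P.prismRotation.length_faceOf_le (by norm_num) ?_) (hc ▸ hle)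
    apply (prismDartEquiv n).injective
    rw [prismDartEquiv_faceNext_pow]
    rw [isMatchingDart_iff] at hd
    generalize prismDartEquiv n d = x at *
    obtain ⟨⟨a, b⟩, c⟩ := x
    obtain rfl : a = b := hd
    exact P.iterate_prismFace_mark a c
  · obtain ⟨d, rfl⟩ : ∃ d, P.prismRotation.faceOf d = f := Quotient.exists_rep f
    replace hc : #S = 3 := (hc.resolve_left fun h => hf h.1).2
    refine le_antisymm (P.prismRotation.length_faceOf_le (by norm_num) ?_) (hc ▸ hle)
    have h1 : ¬ IsMatchingDart d := fun h => hf ⟨d, rfl, h⟩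
    have h2 : ¬ IsMatchingDart (P.prismRotation.faceNext d) := fun h =>
      hf ⟨_, P.prismRotation.faceOf_faceNext d, h⟩
    apply (prismDartEquiv n).injective
    rw [prismDartEquiv_faceNext_pow]
    rw [isMatchingDart_iff] at h1 h2
    rw [prismDartEquiv_faceNext] at h2
    generalize prismDartEquiv n d = x at *
    obtain ⟨⟨a, b⟩, c⟩ := x
    exact P.iterate_prismFace_triangle c h1 h2

end MarkedRotation

/-! ### Translation-invariant marked rotations from voltage arcs. -/

/-- The reversal of voltage arcs: `(i, d, j)` stands for the arcs from `(x, i)` to `(x + d, j)`. -/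
def voltageRev (A ι : Type*) [AddCommGroup A] : Equiv.Perm (ι × A × ι) :=
  Function.Involutive.toPerm (fun x => (x.2.2, -x.2.1, x.1)) fun x => by simp

/-- The face tracing of a marked rotation with vertex set `A × ι` that is invariant under
translations by `A`, in terms of the voltage arcs `(i, d, j)`; the marks are `(i, 0, i)`. -/
structure VoltageFaces (A ι : Type*) [AddCommGroup A] where
  face : Equiv.Perm (ι × A × ι)
  fst_face : ∀ x, (face x).1 = x.2.2
  sameCycle : ∀ x, Equiv.Perm.SameCycle ((voltageRev A ι).trans face) x (x.1, 0, x.1)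
  triangle : ∀ i d j e k, (i, d, j) ≠ (i, 0, i) → (j, e, k) ≠ (j, 0, j) →
    face (i, d, j) = (j, e, k) → face (j, e, k) = (k, -(d + e), i)
  marked : ∀ i d j, (i, d, j) ≠ (i, 0, i) → face (i, d, j) = (j, 0, j) →
    face (i, 0, i) = (i, d, j)

namespace VoltageFaces

variable {A ι : Type*} [AddCommGroup A] (F : VoltageFaces A ι)

/-- Pairs of vertices, as a voltage arc with the first coordinate of its initial vertex. -/
def pairEquiv (A ι : Type*) [AddCommGroup A] : (A × ι) × (A × ι) ≃ A × (ι × A × ι) where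
  toFun p := (p.1.1, (p.1.2, p.2.1 - p.1.1, p.2.2))
  invFun q := ((q.1, q.2.1), (q.1 + q.2.2.1, q.2.2.2))
  left_inv p := by simp
  right_inv q := by simp

/-- The rotation induced by the face tracing. -/
def rot : Equiv.Perm (ι × A × ι) := (voltageRev A ι).trans F.face

theorem rot_apply (i : ι) (d : A) (j : ι) : F.rot (i, d, j) = F.face (j, -d, i) := rfl

/-- The lifted rotation. -/
def liftNext : Equiv.Perm ((A × ι) × (A × ι)) :=
  (pairEquiv A ι).symm.permCongr ((Equiv.refl A).prodCongr F.rot)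

/-- Turns each axiom of the lifted rotation into a statement about voltages, since `liftNext` at
`(b, a)` continues the face through the arc from `a` to `b`. -/
theorem liftNext_eq_iff (a b c : A × ι) : F.liftNext (b, a) = (b, c) ↔
    F.face (a.2, b.1 - a.1, b.2) = (b.2, c.1 - b.1, c.2) := by
  rw [liftNext, Equiv.permCongr_apply, Equiv.symm_symm, Equiv.symm_apply_eq]
  simp [pairEquiv, rot_apply]

theorem liftNext_pow (k : ℕ) : F.liftNext ^ k =
    (pairEquiv A ι).symm.permCongr ((Equiv.refl A).prodCongr (F.rot ^ k)) := by
  induction k with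
  | zero => ext <;> simp [Equiv.permCongr_apply]
  | succ k ih =>
    rw [pow_succ, ih, pow_succ]
    ext p <;> simp [liftNext, Equiv.permCongr_apply] <;> rfl

theorem ne_of_vertices_ne {a b : A × ι} (h : a ≠ b) :
    (a.2, b.1 - a.1, b.2) ≠ (a.2, 0, a.2) := by
  intro h'
  simp only [Prod.mk.injEq, true_and] at h'
  exact h (Prod.ext (sub_eq_zero.1 h'.1).symm h'.2.symm)

/-- The marked rotation on `A × ι` described by the voltage arcs. -/
def lift [Finite A] [Finite ι] : MarkedRotation (A × ι) where
  next := F.liftNext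
  fst_next p := by
    obtain ⟨⟨x, i⟩, ⟨y, j⟩⟩ := p
    have h := F.fst_face (j, -(y - x), i)
    simp only [liftNext, Equiv.permCongr_apply, pairEquiv, Equiv.symm_symm, Equiv.coe_fn_mk,
      Equiv.prodCongr_apply, Prod.map_apply, Equiv.refl_apply, rot_apply, Equiv.coe_fn_symm_mk]
    rw [h]
  sameCycle_next a b c := by
    have key : ∀ b, F.liftNext.SameCycle (a, b) (a, a) := by
      intro b
      obtain ⟨k, -, hk⟩ := (F.sameCycle (a.2, b.1 - a.1, b.2)).exists_pow_eq'
      refine ⟨k, ?_⟩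
      rw [zpow_natCast, liftNext_pow, Equiv.permCongr_apply, Equiv.symm_symm,
        Equiv.symm_apply_eq]
      refine (congrArg (Prod.mk a.1) hk).trans ?_
      simp [pairEquiv]
    exact (key b).trans (key c).symm
  triangle a b c hab hcb h := by
    rw [liftNext_eq_iff] at h ⊢
    rw [F.triangle _ _ _ _ _ (ne_of_vertices_ne hab) (ne_of_vertices_ne hcb.symm) h]
    simp
  marked a b hab h := by
    rw [liftNext_eq_iff] at h ⊢
    rw [sub_self] at h ⊢
    exact F.marked _ _ _ (ne_of_vertices_ne hab) h

end VoltageFaces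

/-! ### The explicit triangles, ladders and marked faces. -/

/-- An oriented triangle of voltage arcs, given by its three classes and the voltages of its first
two arcs. -/
structure VoltageTriangle where
  i : Fin 3
  a : ℤ
  j : Fin 3
  b : ℤ
  k : Fin 3

/-- The sides of an oriented triangle. -/
def VoltageTriangle.side (T : VoltageTriangle) : Fin 3 → Fin 3 × ℤ × Fin 3 :=
  ![(T.i, T.a, T.j), (T.j, T.b, T.k), (T.k, -(T.a + T.b), T.i)]

/-- The triangles of a ladder: four families of triangles with two vertices in the class `i` and one
vertex in the class `i + 1`. -/
def ladder (i : Fin 3) (N C σ : ℤ) (x : Fin 4) (a : ℤ) : VoltageTriangle :=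
  ![⟨i, σ + N - a, i + 1, -(σ + a), i⟩, ⟨i, σ + a + 1, i + 1, -(σ + N - a), i⟩,
    ⟨i, σ + C - N + a, i + 1, -(σ + C - a), i⟩, ⟨i, σ + C - a - 1, i + 1, -(σ + C - N + a), i⟩] x

/-- The triangles outside the ladders. -/
def extraTriangle (t : ℤ) : Fin 15 → VoltageTriangle :=
  ![⟨0, t + 1, 2, 2 * t + 2, 2⟩, ⟨1, t + 3, 0, -2, 2⟩, ⟨0, -t - 3, 2, 2 * t + 4, 2⟩,
    ⟨0, t, 2, 1, 1⟩, ⟨0, -t - 4, 2, t + 3, 1⟩, ⟨0, 2 * t + 3, 0, 2 * t + 2, 2⟩,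
    ⟨0, -2, 1, -1, 2⟩, ⟨0, -1, 1, 0, 2⟩, ⟨2, 0, 0, -1, 2⟩,
    ⟨0, 0, 1, 2 * t + 2, 2⟩, ⟨1, 2 * t + 3, 1, -1, 1⟩, ⟨2, 2 * t + 3, 2, 2 * t + 5, 2⟩,
    ⟨1, 1, 1, -3, 2⟩, ⟨1, 2 * t + 2, 1, t + 1, 2⟩, ⟨1, 2 * t + 4, 1, -2, 2⟩]

/-- The index set of the triangles. -/
abbrev TriangleIndex (t : ℕ) : Type :=
  (Fin 4 × Fin (t + 1)) ⊕ (Fin 4 × Fin t) ⊕ (Fin 4 × Fin t) ⊕ Fin 15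

/-- All triangles. -/
def triangleOf (t : ℕ) : TriangleIndex t → VoltageTriangle
  | .inl p => ladder 0 (2 * t + 2) (-2) 0 p.1 p.2
  | .inr (.inl p) => ladder 1 (2 * t + 1) (-3) 0 p.1 p.2
  | .inr (.inr (.inl p)) => ladder 2 (2 * t + 1) (-3) 3 p.1 p.2
  | .inr (.inr (.inr e)) => extraTriangle t e

/-- The index set of the voltage arcs and marks, ordered by faces. -/
abbrev ArcIndex (t : ℕ) : Type := (TriangleIndex t × Fin 3) ⊕ (Fin 2 ⊕ Fin 4)

/-- The voltage arcs and marks with integral voltages. -/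
def intArc (t : ℕ) : ArcIndex t → Fin 3 × ℤ × Fin 3
  | .inl p => (triangleOf t p.1).side p.2
  | .inr (.inl e) => ![(0, 2 * (t : ℤ) + 4, 0), (0, 0, 0)] e
  | .inr (.inr e) => ![(1, -(t : ℤ) - 4, 2), (2, 0, 2), (2, -(t : ℤ), 1), (1, 0, 1)] e

/-- The reduction of voltages modulo `4 t + 7`. -/
def reduce (t : ℕ) (x : Fin 3 × ℤ × Fin 3) : Fin 3 × ZMod (4 * t + 7) × Fin 3 :=
  (x.1, (x.2.1 : ZMod (4 * t + 7)), x.2.2)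

theorem reduce_eq {t : ℕ} {i j : Fin 3} {d d' : ℤ} (c : ℤ) (h : d = d' + c * (4 * t + 7)) :
    reduce t (i, d, j) = reduce t (i, d', j) := by
  have h0 : ((4 * t + 7 : ℤ) : ZMod (4 * t + 7)) = 0 := by
    have := ZMod.natCast_self (4 * t + 7)
    exact_mod_cast this
  simp only [reduce, h, Int.cast_add, Int.cast_mul c, h0, mul_zero, add_zero]

/-- The next arc or mark on the same face. -/
def turn (t : ℕ) : Equiv.Perm (ArcIndex t) :=
  Equiv.sumCongr (Equiv.prodCongr (Equiv.refl _) (Equiv.addRight 1))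
    (Equiv.sumCongr (Equiv.addRight 1) (Equiv.addRight 1))

/-- `y` follows `x` in the rotation. -/
def RotStep (t : ℕ) (x y : Fin 3 × ZMod (4 * t + 7) × Fin 3) : Prop :=
  ∃ e : ArcIndex t, reduce t (intArc t e) = voltageRev _ _ x ∧ reduce t (intArc t (turn t e)) = y

/-- The arcs `(i, d, j)` and `(i, d', j')` belong to the same cycle of the rotation. -/
def Conn (t : ℕ) (i : Fin 3) (d : ℤ) (j : Fin 3) (d' : ℤ) (j' : Fin 3) : Prop :=
  Relation.EqvGen (RotStep t) (reduce t (i, d, j)) (reduce t (i, d', j'))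

theorem Conn.refl {t : ℕ} {i : Fin 3} {d : ℤ} {j : Fin 3} : Conn t i d j d j :=
  Relation.EqvGen.refl _

theorem Conn.symm {t : ℕ} {i : Fin 3} {d d' : ℤ} {j j' : Fin 3} (h : Conn t i d j d' j') :
    Conn t i d' j' d j := Relation.EqvGen.symm _ _ h

theorem Conn.trans {t : ℕ} {i : Fin 3} {d d' d'' : ℤ} {j j' j'' : Fin 3} (h : Conn t i d j d' j')
    (h' : Conn t i d' j' d'' j'') : Conn t i d j d'' j'' := Relation.EqvGen.trans _ _ _ h h'

/-- `(i, a, j)`, `(j, b, k)` are consecutive arcs of one of the triangles. -/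
def HasTriangle (t : ℕ) (i : Fin 3) (a : ℤ) (j : Fin 3) (b : ℤ) (k : Fin 3) : Prop :=
  ∃ (e : TriangleIndex t) (r : Fin 3), reduce t ((triangleOf t e).side r) = reduce t (i, a, j) ∧
    reduce t ((triangleOf t e).side (r + 1)) = reduce t (j, b, k) ∧
    reduce t ((triangleOf t e).side (r + 2)) = reduce t (k, -(a + b), i)

namespace HasTriangle

variable {t : ℕ} {i j k : Fin 3} {a b : ℤ}

theorem rotate (h : HasTriangle t i a j b k) : HasTriangle t j b k (-(a + b)) i := by
  obtain ⟨e, r, h1, h2, h3⟩ := h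
  refine ⟨e, r + 1, h2, ?_, ?_⟩
  · rw [add_assoc]; exact h3
  · have h : ∀ r : Fin 3, r + 1 + 2 = r := by decide
    rw [h, h1]
    congr 3
    ring

/-- Voltages are kept as integers, for `ring` and `omega`; `c` and `e` count the multiples of the
modulus dropped. -/
theorem congr {a' b' : ℤ} (h : HasTriangle t i a j b k) (c e : ℤ) (ha : a = a' + c * (4 * t + 7))
    (hb : b = b' + e * (4 * t + 7)) : HasTriangle t i a' j b' k := by
  obtain ⟨x, r, h1, h2, h3⟩ := h
  refine ⟨x, r, h1.trans (reduce_eq c ha), h2.trans (reduce_eq e hb),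
    h3.trans (reduce_eq (-(c + e)) ?_)⟩
  rw [ha, hb]
  ring

theorem mem_range (h : HasTriangle t i a j b k) :
    reduce t (i, a, j) ∈ Set.range (reduce t ∘ intArc t) := by
  obtain ⟨e, r, h1, -⟩ := h
  exact ⟨.inl (e, r), h1⟩

theorem conn (h : HasTriangle t i a j b k) : Conn t j (-a) i b k := by
  obtain ⟨e, r, h1, h2, -⟩ := h
  refine Relation.EqvGen.rel _ _ ⟨.inl (e, r), h1.trans ?_, h2⟩
  change _ = (i, -((-a : ℤ) : ZMod (4 * t + 7)), j)
  simp [reduce]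

end HasTriangle

theorem hasTriangle_triangleOf {t : ℕ} (e : TriangleIndex t) {i j k : Fin 3} {a b : ℤ}
    (h : triangleOf t e = ⟨i, a, j, b, k⟩) : HasTriangle t i a j b k :=
  ⟨e, 0, by rw [h]; rfl, by rw [h]; rfl, by rw [h]; rfl⟩

/-- A ladder with `4 l` triangles. -/
structure IsLadder (t : ℕ) (i : Fin 3) (N C σ : ℤ) (l : ℕ) : Prop where
  h₀ : ∀ a : ℕ, a < l → HasTriangle t i (σ + N - a) (i + 1) (-(σ + a)) i
  h₁ : ∀ a : ℕ, a < l → HasTriangle t i (σ + a + 1) (i + 1) (-(σ + N - a)) i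
  h₂ : ∀ a : ℕ, a < l → HasTriangle t i (σ + C - N + a) (i + 1) (-(σ + C - a)) i
  h₃ : ∀ a : ℕ, a < l → HasTriangle t i (σ + C - a - 1) (i + 1) (-(σ + C - N + a)) i

theorem isLadder_zero (t : ℕ) : IsLadder t 0 (2 * t + 2) (-2) 0 (t + 1) :=
  ⟨fun a h => hasTriangle_triangleOf (.inl (0, ⟨a, h⟩)) rfl,
   fun a h => hasTriangle_triangleOf (.inl (1, ⟨a, h⟩)) rfl,
   fun a h => hasTriangle_triangleOf (.inl (2, ⟨a, h⟩)) rfl,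
   fun a h => hasTriangle_triangleOf (.inl (3, ⟨a, h⟩)) rfl⟩

theorem isLadder_one (t : ℕ) : IsLadder t 1 (2 * t + 1) (-3) 0 t :=
  ⟨fun a h => hasTriangle_triangleOf (.inr (.inl (0, ⟨a, h⟩))) rfl,
   fun a h => hasTriangle_triangleOf (.inr (.inl (1, ⟨a, h⟩))) rfl,
   fun a h => hasTriangle_triangleOf (.inr (.inl (2, ⟨a, h⟩))) rfl,
   fun a h => hasTriangle_triangleOf (.inr (.inl (3, ⟨a, h⟩))) rfl⟩

theorem isLadder_two (t : ℕ) : IsLadder t 2 (2 * t + 1) (-3) 3 t :=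
  ⟨fun a h => hasTriangle_triangleOf (.inr (.inr (.inl (0, ⟨a, h⟩)))) rfl,
   fun a h => hasTriangle_triangleOf (.inr (.inr (.inl (1, ⟨a, h⟩)))) rfl,
   fun a h => hasTriangle_triangleOf (.inr (.inr (.inl (2, ⟨a, h⟩)))) rfl,
   fun a h => hasTriangle_triangleOf (.inr (.inr (.inl (3, ⟨a, h⟩)))) rfl⟩

/-! ### Following the rotation through a ladder. -/

/-- The arc `(i, d, j)` occurs, and it belongs to the cycle of the mark at `i`. -/
def Good (t : ℕ) (i : Fin 3) (d : ℤ) (j : Fin 3) : Prop :=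
  reduce t (i, d, j) ∈ Set.range (reduce t ∘ intArc t) ∧ Conn t i d j 0 i

theorem HasTriangle.good {t : ℕ} {i j k : Fin 3} {a b : ℤ} (h : HasTriangle t i a j b k)
    (hc : Conn t i a j 0 i) : Good t i a j := ⟨h.mem_range, hc⟩

namespace IsLadder

variable {t : ℕ} {i : Fin 3} {N C σ : ℤ} {l : ℕ}

/-- Two steps of the rotation, passing through the rung `2a - N`. -/
theorem conn_bottom_high (H : IsLadder t i N C σ l) {a : ℕ} (h : a < l) :
    Conn t i (σ + a) (i + 1) (σ + C - N + a) (i + 1) := by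
  have h1 : Conn t i (σ + a) (i + 1) (2 * a - N) i := by
    convert (H.h₀ a h).rotate.conn using 1 <;> ring
  have h2 : Conn t i (2 * a - N) i (σ + C - N + a) (i + 1) := by
    convert (H.h₂ a h).rotate.rotate.conn using 1 <;> ring
  exact h1.trans h2

theorem conn_top_high (H : IsLadder t i N C σ l) {a : ℕ} (h : a < l) :
    Conn t i (σ + C - a) (i + 1) (σ + N - a) (i + 1) := by
  have h1 : Conn t i (σ + C - a) (i + 1) (N - 2 * a) i := by
    convert (H.h₂ a h).rotate.conn using 1 <;> ring
  have h2 : Conn t i (N - 2 * a) i (σ + N - a) (i + 1) := by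
    convert (H.h₀ a h).rotate.rotate.conn using 1 <;> ring
  exact h1.trans h2

/-- The rotation at `i` zigzags: from `σ + a` over a rung to `σ + C - N + a`, then over the next
rung to `σ + a + 1`. Thus a ladder acts on this cycle as a single wire from `σ` to `σ + l`;
`conn_bottom` is the other wire, starting at `σ + C`. -/
theorem conn_top (H : IsLadder t i N C σ l) {a : ℕ} (h : a ≤ l) :
    Conn t i (σ + a) (i + 1) σ (i + 1) := by
  induction a with
  | zero => convert Conn.refl using 1; simp
  | succ a ih =>
    have h1 : Conn t i (σ + C - N + a) (i + 1) (2 * a + 1 - N) i := by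
      convert (H.h₃ a h).rotate.conn using 1 <;> ring
    have h2 : Conn t i (2 * a + 1 - N) i (σ + (a + 1 : ℕ)) (i + 1) := by
      convert (H.h₁ a h).rotate.rotate.conn using 1 <;> push_cast <;> ring
    exact h2.symm.trans (h1.symm.trans ((H.conn_bottom_high h).symm.trans (ih (by omega))))

theorem conn_bottom (H : IsLadder t i N C σ l) {a : ℕ} (h : a ≤ l) :
    Conn t i (σ + C - a) (i + 1) (σ + C) (i + 1) := by
  induction a with
  | zero => convert Conn.refl using 1; simp
  | succ a ih =>
    have h1 : Conn t i (σ + N - a) (i + 1) (N - 2 * a - 1) i := by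
      convert (H.h₁ a h).rotate.conn using 1 <;> ring
    have h2 : Conn t i (N - 2 * a - 1) i (σ + C - (a + 1 : ℕ)) (i + 1) := by
      convert (H.h₃ a h).rotate.rotate.conn using 1 <;> push_cast <;> ring
    exact h2.symm.trans (h1.symm.trans ((H.conn_top_high h).symm.trans (ih (by omega))))

theorem conn_outer_top_high (H : IsLadder t i N C σ l) {a : ℕ} (h : a < l) :
    Conn t (i + 1) (-(σ + N - a)) i (-(σ + a)) i := (H.h₀ a h).conn

theorem conn_outer_bottom_high (H : IsLadder t i N C σ l) {a : ℕ} (h : a < l) :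
    Conn t (i + 1) (-(σ + C - N + a)) i (-(σ + C - a)) i := (H.h₂ a h).conn

/-- At `i + 1` no rungs are met: the voltages alternate between the low and the high end of the
ladder, moving inwards. -/
theorem conn_outer_top (H : IsLadder t i N C σ l) {a : ℕ} (h : a ≤ l) :
    Conn t (i + 1) (-(σ + a)) i (-σ) i := by
  induction a with
  | zero => convert Conn.refl using 1; simp
  | succ a ih =>
    have h1 : Conn t (i + 1) (-(σ + (a + 1 : ℕ))) i (-(σ + N - a)) i := by
      convert (H.h₁ a h).conn using 1; push_cast; ring
    exact h1.trans ((H.conn_outer_top_high h).trans (ih (by omega)))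

theorem conn_outer_bottom (H : IsLadder t i N C σ l) {a : ℕ} (h : a ≤ l) :
    Conn t (i + 1) (-(σ + C - a)) i (-(σ + C)) i := by
  induction a with
  | zero => convert Conn.refl using 1; simp
  | succ a ih =>
    have h1 : Conn t (i + 1) (-(σ + C - (a + 1 : ℕ))) i (-(σ + C - N + a)) i := by
      convert (H.h₃ a h).conn using 1; push_cast; ring
    exact h1.trans ((H.conn_outer_bottom_high h).trans (ih (by omega)))

/-- Here and below, a whole interval of voltages is settled once the end `σ` or `σ + C` of its wire
is known to lie on the cycle of the mark. -/
theorem good_top_low (H : IsLadder t i N C σ l) (hE : Conn t i σ (i + 1) 0 i) {d : ℤ}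
    (h₁ : σ + 1 ≤ d) (h₂ : d ≤ σ + l) : Good t i d (i + 1) := by
  obtain ⟨a, rfl⟩ : ∃ a : ℕ, d = σ + a + 1 := ⟨(d - σ - 1).toNat, by omega⟩
  refine (H.h₁ a (by omega)).good (.trans ?_ hE)
  convert H.conn_top (a := a + 1) (by omega) using 1
  push_cast
  ring

theorem good_top_high (H : IsLadder t i N C σ l) (hF : Conn t i (σ + C) (i + 1) 0 i) {d : ℤ}
    (h₁ : σ + N - l + 1 ≤ d) (h₂ : d ≤ σ + N) : Good t i d (i + 1) := by
  obtain ⟨a, rfl⟩ : ∃ a : ℕ, d = σ + N - a := ⟨(σ + N - d).toNat, by omega⟩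
  have ha : a < l := by omega
  exact (H.h₀ a ha).good ((H.conn_top_high ha).symm.trans ((H.conn_bottom ha.le).trans hF))

theorem good_bottom_low (H : IsLadder t i N C σ l) (hF : Conn t i (σ + C) (i + 1) 0 i) {d : ℤ}
    (h₁ : σ + C - l ≤ d) (h₂ : d ≤ σ + C - 1) : Good t i d (i + 1) := by
  obtain ⟨a, rfl⟩ : ∃ a : ℕ, d = σ + C - a - 1 := ⟨(σ + C - 1 - d).toNat, by omega⟩
  refine (H.h₃ a (by omega)).good (.trans ?_ hF)
  convert H.conn_bottom (a := a + 1) (by omega) using 1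
  push_cast
  ring

theorem good_bottom_high (H : IsLadder t i N C σ l) (hE : Conn t i σ (i + 1) 0 i) {d : ℤ}
    (h₁ : σ + C - N ≤ d) (h₂ : d ≤ σ + C - N + l - 1) : Good t i d (i + 1) := by
  obtain ⟨a, rfl⟩ : ∃ a : ℕ, d = σ + C - N + a := ⟨(d - (σ + C - N)).toNat, by omega⟩
  have ha : a < l := by omega
  exact (H.h₂ a ha).good ((H.conn_bottom_high ha).symm.trans ((H.conn_top ha.le).trans hE))

theorem good_outer_top_low (H : IsLadder t i N C σ l)
    (hP : Conn t (i + 1) (-σ) i 0 (i + 1)) {d : ℤ}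
    (h₁ : σ ≤ -d) (h₂ : -d ≤ σ + l - 1) : Good t (i + 1) d i := by
  obtain ⟨a, rfl⟩ : ∃ a : ℕ, d = -(σ + a) := ⟨(-d - σ).toNat, by omega⟩
  have ha : a < l := by omega
  exact (H.h₀ a ha).rotate.good ((H.conn_outer_top ha.le).trans hP)

theorem good_outer_top_high (H : IsLadder t i N C σ l)
    (hP : Conn t (i + 1) (-σ) i 0 (i + 1)) {d : ℤ}
    (h₁ : σ + N - l + 1 ≤ -d) (h₂ : -d ≤ σ + N) : Good t (i + 1) d i := by
  obtain ⟨a, rfl⟩ : ∃ a : ℕ, d = -(σ + N - a) := ⟨(σ + N + d).toNat, by omega⟩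
  have ha : a < l := by omega
  exact (H.h₁ a ha).rotate.good
    ((H.conn_outer_top_high ha).trans ((H.conn_outer_top ha.le).trans hP))

theorem good_outer_bottom_low (H : IsLadder t i N C σ l)
    (hQ : Conn t (i + 1) (-(σ + C)) i 0 (i + 1)) {d : ℤ}
    (h₁ : σ + C - l + 1 ≤ -d) (h₂ : -d ≤ σ + C) : Good t (i + 1) d i := by
  obtain ⟨a, rfl⟩ : ∃ a : ℕ, d = -(σ + C - a) := ⟨(σ + C + d).toNat, by omega⟩
  have ha : a < l := by omega
  exact (H.h₂ a ha).rotate.good ((H.conn_outer_bottom ha.le).trans hQ)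

theorem good_outer_bottom_high (H : IsLadder t i N C σ l)
    (hQ : Conn t (i + 1) (-(σ + C)) i 0 (i + 1)) {d : ℤ}
    (h₁ : σ + C - N ≤ -d) (h₂ : -d ≤ σ + C - N + l - 1) : Good t (i + 1) d i := by
  obtain ⟨a, rfl⟩ : ∃ a : ℕ, d = -(σ + C - N + a) := ⟨(-d - (σ + C - N)).toNat, by omega⟩
  have ha : a < l := by omega
  exact (H.h₃ a ha).rotate.good
    ((H.conn_outer_bottom_high ha).trans ((H.conn_outer_bottom ha.le).trans hQ))

theorem good_rung (H : IsLadder t i N C σ l) (hE : Conn t i σ (i + 1) 0 i)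
    (hF : Conn t i (σ + C) (i + 1) 0 i) {d : ℤ}
    (h : N - 2 * l + 1 ≤ d ∧ d ≤ N ∨ N - 2 * l + 1 ≤ -d ∧ -d ≤ N) : Good t i d i := by
  have hE' : ∀ {a : ℕ}, a < l → Conn t i (σ + C - N + a) (i + 1) 0 i := fun ha =>
    (H.conn_bottom_high ha).symm.trans ((H.conn_top ha.le).trans hE)
  have hF' : ∀ {a : ℕ}, a < l → Conn t i (σ + N - a) (i + 1) 0 i := fun ha =>
    (H.conn_top_high ha).symm.trans ((H.conn_bottom ha.le).trans hF)
  rcases h with ⟨h₁, h₂⟩ | ⟨h₁, h₂⟩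
  -- The parity of `N - d` decides which of the families contains the rung.
  · obtain ⟨a, rfl | rfl⟩ : ∃ a : ℕ, d = N - 2 * a ∨ d = N - 2 * a - 1 :=
      ⟨((N - d) / 2).toNat, by omega⟩
    · have ha : a < l := by omega
      have hT : HasTriangle t i (N - 2 * a) i (σ + C - N + a) (i + 1) := by
        convert (H.h₂ a ha).rotate.rotate using 1 <;> ring
      refine hT.good ((Conn.symm ?_).trans ((H.conn_bottom ha.le).trans hF))
      convert (H.h₂ a ha).rotate.conn using 1 <;> ring
    · have ha : a < l := by omega
      have hT : HasTriangle t i (N - 2 * a - 1) i (σ + a + 1) (i + 1) := by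
        convert (H.h₁ a ha).rotate.rotate using 1 <;> ring
      refine hT.good ((Conn.symm ?_).trans (hF' ha))
      convert (H.h₁ a ha).rotate.conn using 1 <;> ring
  · obtain ⟨a, ha'⟩ : ∃ a : ℕ, d = 2 * a - N ∨ d = 2 * a + 1 - N :=
      ⟨((N + d) / 2).toNat, by omega⟩
    rcases ha' with rfl | rfl
    · have ha : a < l := by omega
      have hT : HasTriangle t i (2 * a - N) i (σ + N - a) (i + 1) := by
        convert (H.h₀ a ha).rotate.rotate using 1 <;> ring
      refine hT.good ((Conn.symm ?_).trans ((H.conn_top ha.le).trans hE))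
      convert (H.h₀ a ha).rotate.conn using 1 <;> ring
    · have ha : a < l := by omega
      have hT : HasTriangle t i (2 * a + 1 - N) i (σ + C - a - 1) (i + 1) := by
        convert (H.h₃ a ha).rotate.rotate using 1 <;> ring
      refine hT.good ((Conn.symm ?_).trans (hE' ha))
      convert (H.h₃ a ha).rotate.conn using 1 <;> ring

end IsLadder

/-! ### The rotations at the three classes. -/

theorem Conn.of_eq {t : ℕ} {i j j' : Fin 3} {a b a' b' : ℤ} (h : Conn t i a j b j') (ha : a = a')
    (hb : b = b') : Conn t i a' j b' j' := by rwa [← ha, ← hb]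

theorem HasTriangle.step {t : ℕ} {i j k : Fin 3} {a b d d' : ℤ} (h : HasTriangle t i a j b k)
    (c c' : ℤ) (ha : a = -d + c * (4 * t + 7)) (hb : b = d' + c' * (4 * t + 7)) :
    Conn t j d i d' k := by
  simpa using (h.congr c c' ha hb).conn

theorem HasTriangle.good_of_eq {t : ℕ} {i j k : Fin 3} {a b d : ℤ} (h : HasTriangle t i a j b k)
    (c : ℤ) (ha : a = d + c * (4 * t + 7)) (hc : Conn t i d j 0 i) : Good t i d j :=
  (h.congr c 0 ha (by ring)).good hc

theorem extra {t : ℕ} (e : Fin 15) {i j k : Fin 3} {a b : ℤ}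
    (h : extraTriangle t e = ⟨i, a, j, b, k⟩) : HasTriangle t i a j b k :=
  hasTriangle_triangleOf (.inr (.inr (.inr e))) h

theorem vortex_step {t : ℕ} (e : Fin 2 ⊕ Fin 4) {i j k : Fin 3} {a b d d' : ℤ} (c c' : ℤ)
    (h : intArc t (.inr e) = (i, a, j)) (h' : intArc t (turn t (.inr e)) = (j, b, k))
    (ha : a = -d + c * (4 * t + 7)) (hb : b = d' + c' * (4 * t + 7)) : Conn t j d i d' k := by
  refine Relation.EqvGen.rel _ _ ⟨.inr e, ?_, ?_⟩
  · rw [h, reduce_eq c ha]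
    change _ = (i, -(d : ZMod (4 * t + 7)), j)
    simp [reduce]
  · rw [h', reduce_eq c' hb]

theorem vortex_good {t : ℕ} (e : Fin 2 ⊕ Fin 4) {i j : Fin 3} {a d : ℤ} (c : ℤ)
    (h : intArc t (.inr e) = (i, a, j)) (ha : a = d + c * (4 * t + 7)) (hc : Conn t i d j 0 i) :
    Good t i d j :=
  ⟨⟨.inr e, by rw [Function.comp_apply, h, reduce_eq c ha]⟩, hc⟩

/-- The chain `c0`, `c1`, ... follows the rotation at class 0 from its mark, with each ladder wire
contracted to one link. The windows are 4t+7 consecutive representatives, chosen so that they split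
into ladder intervals and isolated voltages of extra triangles or marked faces. -/
theorem good_row_zero (t : ℕ) :
    (∀ d : ℤ, -(2 * t) - 3 ≤ d → d ≤ 2 * t + 3 → Good t 0 d 0) ∧
    (∀ d : ℤ, -(2 * t) - 4 ≤ d → d ≤ 2 * t + 2 → Good t 0 d 1) ∧
    (∀ d : ℤ, -(2 * t) - 5 ≤ d → d ≤ 2 * t + 1 → Good t 0 d 2) := by
  have c0 : Conn t 0 0 0 0 0 := .refl
  have c1 : Conn t 0 (-(2 * t) - 3) 0 0 0 :=
    (vortex_step (.inl 1) (0) (1) rfl rfl (by ring) (by ring)).symm.trans c0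
  have c2 : Conn t 0 (-(2 * t) - 5) 2 0 0 :=
    ((extra 5 rfl).step (0) (1) (by ring) (by ring)).symm.trans c1
  have c3 : Conn t 0 (0) 1 0 0 :=
    ((extra 9 rfl).rotate.rotate.step (-1) (0) (by ring) (by ring)).symm.trans c2
  have c4 : Conn t 0 (t + 1) 1 0 0 :=
    ((Conn.of_eq ((isLadder_zero t).conn_top le_rfl) (by omega) (by omega))).trans c3
  have c5 : Conn t 0 (t) 2 0 0 :=
    ((extra 3 rfl).rotate.rotate.step (0) (0) (by ring) (by ring)).symm.trans c4
  -- The outer side of ladder 2 lies in class 0, since 2 + 1 = 0 in `Fin 3`.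
  have c6 : Conn t 0 (0) 2 0 0 :=
    ((Conn.of_eq ((isLadder_two t).conn_outer_bottom le_rfl) (by omega) (by omega)).symm).trans c5
  have c7 : Conn t 0 (-1) 2 0 0 :=
    ((extra 8 rfl).step (0) (0) (by ring) (by ring)).symm.trans c6
  have c8 : Conn t 0 (-1) 1 0 0 :=
    ((extra 7 rfl).rotate.rotate.step (0) (0) (by ring) (by ring)).symm.trans c7
  have c9 : Conn t 0 (-t - 4) 2 0 0 :=
    ((extra 4 rfl).rotate.rotate.step (0) (0) (by ring) (by ring)).symm.trans c8
  have c10 : Conn t 0 (t + 1) 2 0 0 :=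
    ((extra 0 rfl).rotate.rotate.step (-1) (0) (by ring) (by ring)).symm.trans c9
  have c11 : Conn t 0 (-t - 3) 2 0 0 :=
    ((extra 2 rfl).rotate.rotate.step (0) (0) (by ring) (by ring)).symm.trans c10
  have c12 : Conn t 0 (-3) 2 0 0 :=
    ((Conn.of_eq ((isLadder_two t).conn_outer_top le_rfl) (by omega) (by omega)).symm).trans c11
  have c13 : Conn t 0 (-2) 1 0 0 :=
    ((extra 6 rfl).rotate.rotate.step (0) (0) (by ring) (by ring)).symm.trans c12
  have c14 : Conn t 0 (-t - 3) 1 0 0 :=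
    ((Conn.of_eq ((isLadder_zero t).conn_bottom le_rfl) (by omega) (by omega))).trans c13
  have c15 : Conn t 0 (-2) 2 0 0 :=
    ((extra 1 rfl).step (0) (0) (by ring) (by ring)).symm.trans c14
  have c16 : Conn t 0 (2 * t + 3) 0 0 0 :=
    ((extra 5 rfl).rotate.rotate.step (-1) (0) (by ring) (by ring)).symm.trans c15
  refine ⟨fun d h₁ h₂ => ?_, fun d h₁ h₂ => ?_, fun d h₁ h₂ => ?_⟩
  · have h : d = -(2 * t) - 3 ∨
        -(2 * t) - 2 ≤ d ∧ d ≤ -1 ∨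
        d = 0 ∨
        1 ≤ d ∧ d ≤ 2 * t + 2 ∨
        d = 2 * t + 3 := by omega
    rcases h with rfl | h | rfl | h | rfl
    · exact vortex_good (.inl 0) (1) rfl (by ring) c1
    · exact (isLadder_zero t).good_rung c3 c13 (by omega)
    · exact vortex_good (.inl 1) (0) rfl (by ring) c0
    · exact (isLadder_zero t).good_rung c3 c13 (by omega)
    · exact (extra 5 rfl).good_of_eq (0) (by ring) c16
  · have h : -(2 * t) - 4 ≤ d ∧ d ≤ -t - 4 ∨
        -t - 3 ≤ d ∧ d ≤ -3 ∨
        d = -2 ∨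
        d = -1 ∨
        d = 0 ∨
        1 ≤ d ∧ d ≤ t + 1 ∨
        t + 2 ≤ d ∧ d ≤ 2 * t + 2 := by omega
    rcases h with h | h | rfl | rfl | rfl | h | h
    · exact (isLadder_zero t).good_bottom_high c3 (by omega) (by omega)
    · exact (isLadder_zero t).good_bottom_low c13 (by omega) (by omega)
    · exact (extra 6 rfl).good_of_eq (0) (by ring) c13
    · exact (extra 7 rfl).good_of_eq (0) (by ring) c8
    · exact (extra 9 rfl).good_of_eq (0) (by ring) c3
    · exact (isLadder_zero t).good_top_low c3 (by omega) (by omega)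
    · exact (isLadder_zero t).good_top_high c13 (by omega) (by omega)
  · have h : d = -(2 * t) - 5 ∨
        -(2 * t) - 4 ≤ d ∧ d ≤ -t - 5 ∨
        d = -t - 4 ∨
        d = -t - 3 ∨
        -t - 2 ≤ d ∧ d ≤ -3 ∨
        d = -2 ∨
        d = -1 ∨
        0 ≤ d ∧ d ≤ t - 1 ∨
        d = t ∨
        d = t + 1 ∨
        t + 2 ≤ d ∧ d ≤ 2 * t + 1 := by omega
    rcases h with rfl | h | rfl | rfl | h | rfl | rfl | h | rfl | rfl | h
    · exact (extra 5 rfl).rotate.good_of_eq (1) (by ring) c2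
    · exact (isLadder_two t).good_outer_top_high c12 (by omega) (by omega)
    · exact (extra 4 rfl).good_of_eq (0) (by ring) c9
    · exact (extra 2 rfl).good_of_eq (0) (by ring) c11
    · exact (isLadder_two t).good_outer_top_low c12 (by omega) (by omega)
    · exact (extra 1 rfl).rotate.good_of_eq (0) (by ring) c15
    · exact (extra 8 rfl).rotate.good_of_eq (0) (by ring) c7
    · exact (isLadder_two t).good_outer_bottom_low c6 (by omega) (by omega)
    · exact (extra 3 rfl).good_of_eq (0) (by ring) c5
    · exact (extra 0 rfl).good_of_eq (0) (by ring) c10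
    · exact (isLadder_two t).good_outer_bottom_high c6 (by omega) (by omega)

/-- The wire ends are `c12`, `c9` for the outer side of ladder 0 and `c19`, `c16` for the inner side
of ladder 1. -/
theorem good_row_one (t : ℕ) :
    (∀ d : ℤ, -(2 * t) - 2 ≤ d → d ≤ 2 * t + 4 → Good t 1 d 0) ∧
    (∀ d : ℤ, -(2 * t) - 3 ≤ d → d ≤ 2 * t + 3 → Good t 1 d 1) ∧
    (∀ d : ℤ, -(2 * t) - 4 ≤ d → d ≤ 2 * t + 2 → Good t 1 d 2) := by
  have c0 : Conn t 1 0 1 0 1 := .refl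
  have c1 : Conn t 1 (-t - 4) 2 0 1 :=
    (vortex_step (.inr 3) (0) (0) rfl rfl (by ring) (by ring)).symm.trans c0
  have c2 : Conn t 1 (2 * t + 2) 1 0 1 :=
    ((extra 13 rfl).rotate.rotate.step (-1) (0) (by ring) (by ring)).symm.trans c1
  have c3 : Conn t 1 (2 * t + 3) 1 0 1 :=
    ((extra 10 rfl).rotate.rotate.step (0) (0) (by ring) (by ring)).symm.trans c2
  have c4 : Conn t 1 (-2) 2 0 1 :=
    ((extra 14 rfl).step (1) (0) (by ring) (by ring)).symm.trans c3
  have c5 : Conn t 1 (1) 1 0 1 :=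
    ((extra 12 rfl).rotate.rotate.step (0) (0) (by ring) (by ring)).symm.trans c4
  have c6 : Conn t 1 (-(2 * t) - 2) 1 0 1 :=
    ((extra 10 rfl).rotate.step (0) (0) (by ring) (by ring)).symm.trans c5
  have c7 : Conn t 1 (t + 1) 2 0 1 :=
    ((extra 13 rfl).step (0) (0) (by ring) (by ring)).symm.trans c6
  have c8 : Conn t 1 (t + 3) 0 0 1 :=
    ((extra 1 rfl).rotate.rotate.step (0) (0) (by ring) (by ring)).symm.trans c7
  have c9 : Conn t 1 (2) 0 0 1 :=
    ((Conn.of_eq ((isLadder_zero t).conn_outer_bottom le_rfl) (by omega) (by omega)).symm).trans c8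
  have c10 : Conn t 1 (-1) 2 0 1 :=
    ((extra 6 rfl).step (0) (0) (by ring) (by ring)).symm.trans c9
  have c11 : Conn t 1 (-t - 1) 0 0 1 :=
    ((extra 3 rfl).rotate.step (0) (0) (by ring) (by ring)).symm.trans c10
  have c12 : Conn t 1 (0) 0 0 1 :=
    ((Conn.of_eq ((isLadder_zero t).conn_outer_top le_rfl) (by omega) (by omega)).symm).trans c11
  have c13 : Conn t 1 (2 * t + 2) 2 0 1 :=
    ((extra 9 rfl).step (0) (0) (by ring) (by ring)).symm.trans c12
  have c14 : Conn t 1 (-(2 * t) - 3) 1 0 1 :=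
    ((extra 14 rfl).rotate.rotate.step (0) (1) (by ring) (by ring)).symm.trans c13
  have c15 : Conn t 1 (-1) 1 0 1 :=
    ((extra 10 rfl).step (0) (0) (by ring) (by ring)).symm.trans c14
  have c16 : Conn t 1 (-3) 2 0 1 :=
    ((extra 12 rfl).step (0) (0) (by ring) (by ring)).symm.trans c15
  have c17 : Conn t 1 (-t - 3) 2 0 1 :=
    ((Conn.of_eq ((isLadder_one t).conn_bottom le_rfl) (by omega) (by omega))).trans c16
  have c18 : Conn t 1 (1) 0 0 1 :=
    ((extra 4 rfl).rotate.step (0) (0) (by ring) (by ring)).symm.trans c17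
  have c19 : Conn t 1 (0) 2 0 1 :=
    ((extra 7 rfl).step (0) (0) (by ring) (by ring)).symm.trans c18
  have c20 : Conn t 1 (t) 2 0 1 :=
    ((Conn.of_eq ((isLadder_one t).conn_top le_rfl) (by omega) (by omega))).trans c19
  refine ⟨fun d h₁ h₂ => ?_, fun d h₁ h₂ => ?_, fun d h₁ h₂ => ?_⟩
  · have h : -(2 * t) - 2 ≤ d ∧ d ≤ -t - 2 ∨
        d = -t - 1 ∨
        -t ≤ d ∧ d ≤ 0 ∨
        d = 1 ∨
        2 ≤ d ∧ d ≤ t + 2 ∨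
        d = t + 3 ∨
        t + 4 ≤ d ∧ d ≤ 2 * t + 4 := by omega
    rcases h with h | rfl | h | rfl | h | rfl | h
    · exact (isLadder_zero t).good_outer_top_high c12 (by omega) (by omega)
    · exact (extra 3 rfl).rotate.rotate.good_of_eq (0) (by ring) c11
    · exact (isLadder_zero t).good_outer_top_low c12 (by omega) (by omega)
    · exact (extra 4 rfl).rotate.rotate.good_of_eq (0) (by ring) c18
    · exact (isLadder_zero t).good_outer_bottom_low c9 (by omega) (by omega)
    · exact (extra 1 rfl).good_of_eq (0) (by ring) c8
    · exact (isLadder_zero t).good_outer_bottom_high c9 (by omega) (by omega)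
  · have h : d = -(2 * t) - 3 ∨
        d = -(2 * t) - 2 ∨
        -(2 * t) - 1 ≤ d ∧ d ≤ -2 ∨
        d = -1 ∨
        d = 0 ∨
        d = 1 ∨
        2 ≤ d ∧ d ≤ 2 * t + 1 ∨
        d = 2 * t + 2 ∨
        d = 2 * t + 3 := by omega
    rcases h with rfl | rfl | h | rfl | rfl | rfl | h | rfl | rfl
    · exact (extra 14 rfl).good_of_eq (1) (by ring) c14
    · exact (extra 10 rfl).rotate.rotate.good_of_eq (0) (by ring) c6
    · exact (isLadder_one t).good_rung c19 c16 (by omega)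
    · exact (extra 10 rfl).rotate.good_of_eq (0) (by ring) c15
    · exact vortex_good (.inr 3) (0) rfl (by ring) c0
    · exact (extra 12 rfl).good_of_eq (0) (by ring) c5
    · exact (isLadder_one t).good_rung c19 c16 (by omega)
    · exact (extra 13 rfl).good_of_eq (0) (by ring) c2
    · exact (extra 10 rfl).good_of_eq (0) (by ring) c3
  · have h : -(2 * t) - 4 ≤ d ∧ d ≤ -t - 5 ∨
        d = -t - 4 ∨
        -t - 3 ≤ d ∧ d ≤ -4 ∨
        d = -3 ∨
        d = -2 ∨
        d = -1 ∨
        d = 0 ∨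
        1 ≤ d ∧ d ≤ t ∨
        d = t + 1 ∨
        t + 2 ≤ d ∧ d ≤ 2 * t + 1 ∨
        d = 2 * t + 2 := by omega
    rcases h with h | rfl | h | rfl | rfl | rfl | rfl | h | rfl | h | rfl
    · exact (isLadder_one t).good_bottom_high c19 (by omega) (by omega)
    · exact vortex_good (.inr 0) (0) rfl (by ring) c1
    · exact (isLadder_one t).good_bottom_low c16 (by omega) (by omega)
    · exact (extra 12 rfl).rotate.good_of_eq (0) (by ring) c16
    · exact (extra 14 rfl).rotate.good_of_eq (0) (by ring) c4
    · exact (extra 6 rfl).rotate.good_of_eq (0) (by ring) c10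
    · exact (extra 7 rfl).rotate.good_of_eq (0) (by ring) c19
    · exact (isLadder_one t).good_top_low c19 (by omega) (by omega)
    · exact (extra 13 rfl).rotate.good_of_eq (0) (by ring) c7
    · exact (isLadder_one t).good_top_high c16 (by omega) (by omega)
    · exact (extra 9 rfl).rotate.good_of_eq (0) (by ring) c13

/-- The wire ends are `c2`, `c18` for the outer side of ladder 1 and `c12`, `c9` for the inner side
of ladder 2, whose offset is `σ = 3`. -/
theorem good_row_two (t : ℕ) :
    (∀ d : ℤ, -(2 * t) - 1 ≤ d → d ≤ 2 * t + 5 → Good t 2 d 0) ∧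
    (∀ d : ℤ, -(2 * t) - 2 ≤ d → d ≤ 2 * t + 4 → Good t 2 d 1) ∧
    (∀ d : ℤ, -(2 * t) - 3 ≤ d → d ≤ 2 * t + 3 → Good t 2 d 2) := by
  have c0 : Conn t 2 0 2 0 2 := .refl
  have c1 : Conn t 2 (-t) 1 0 2 :=
    (vortex_step (.inr 1) (0) (0) rfl rfl (by ring) (by ring)).symm.trans c0
  have c2 : Conn t 2 (0) 1 0 2 :=
    ((Conn.of_eq ((isLadder_one t).conn_outer_top le_rfl) (by omega) (by omega)).symm).trans c1
  have c3 : Conn t 2 (1) 0 0 2 :=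
    ((extra 7 rfl).rotate.step (0) (0) (by ring) (by ring)).symm.trans c2
  have c4 : Conn t 2 (1) 2 0 2 :=
    ((extra 8 rfl).rotate.step (0) (0) (by ring) (by ring)).symm.trans c3
  have c5 : Conn t 2 (2 * t + 3) 2 0 2 :=
    ((extra 11 rfl).rotate.rotate.step (-1) (0) (by ring) (by ring)).symm.trans c4
  have c6 : Conn t 2 (-t - 1) 0 0 2 :=
    ((extra 2 rfl).rotate.step (1) (0) (by ring) (by ring)).symm.trans c5
  have c7 : Conn t 2 (2 * t + 2) 2 0 2 :=
    ((extra 0 rfl).step (0) (0) (by ring) (by ring)).symm.trans c6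
  have c8 : Conn t 2 (-1) 2 0 2 :=
    ((extra 11 rfl).rotate.step (1) (-1) (by ring) (by ring)).symm.trans c7
  have c9 : Conn t 2 (0) 0 0 2 :=
    ((extra 8 rfl).rotate.rotate.step (0) (0) (by ring) (by ring)).symm.trans c8
  have c10 : Conn t 2 (-t) 0 0 2 :=
    ((Conn.of_eq ((isLadder_two t).conn_bottom le_rfl) (by omega) (by omega))).trans c9
  have c11 : Conn t 2 (1) 1 0 2 :=
    ((extra 3 rfl).step (0) (0) (by ring) (by ring)).symm.trans c10
  have c12 : Conn t 2 (3) 0 0 2 :=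
    ((extra 6 rfl).rotate.step (0) (0) (by ring) (by ring)).symm.trans c11
  have c13 : Conn t 2 (t + 3) 0 0 2 :=
    ((Conn.of_eq ((isLadder_two t).conn_top le_rfl) (by omega) (by omega))).trans c12
  have c14 : Conn t 2 (-(2 * t) - 3) 2 0 2 :=
    ((extra 2 rfl).step (0) (1) (by ring) (by ring)).symm.trans c13
  have c15 : Conn t 2 (-(2 * t) - 2) 2 0 2 :=
    ((extra 11 rfl).step (0) (1) (by ring) (by ring)).symm.trans c14
  have c16 : Conn t 2 (t + 4) 0 0 2 :=
    ((extra 0 rfl).rotate.step (0) (-1) (by ring) (by ring)).symm.trans c15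
  have c17 : Conn t 2 (t + 3) 1 0 2 :=
    ((extra 4 rfl).step (0) (0) (by ring) (by ring)).symm.trans c16
  have c18 : Conn t 2 (3) 1 0 2 :=
    ((Conn.of_eq ((isLadder_one t).conn_outer_bottom le_rfl) (by omega) (by omega)).symm).trans c17
  have c19 : Conn t 2 (2) 1 0 2 :=
    ((extra 12 rfl).rotate.step (0) (0) (by ring) (by ring)).symm.trans c18
  have c20 : Conn t 2 (-(2 * t) - 2) 1 0 2 :=
    ((extra 14 rfl).rotate.step (0) (0) (by ring) (by ring)).symm.trans c19
  have c21 : Conn t 2 (2 * t + 5) 0 0 2 :=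
    ((extra 9 rfl).rotate.step (0) (-1) (by ring) (by ring)).symm.trans c20
  have c22 : Conn t 2 (2) 0 0 2 :=
    ((extra 5 rfl).rotate.step (1) (-1) (by ring) (by ring)).symm.trans c21
  have c23 : Conn t 2 (-t - 1) 1 0 2 :=
    ((extra 1 rfl).rotate.step (0) (0) (by ring) (by ring)).symm.trans c22
  have c24 : Conn t 2 (t + 4) 1 0 2 :=
    ((extra 13 rfl).rotate.step (0) (-1) (by ring) (by ring)).symm.trans c23
  refine ⟨fun d h₁ h₂ => ?_, fun d h₁ h₂ => ?_, fun d h₁ h₂ => ?_⟩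
  · have h : -(2 * t) - 1 ≤ d ∧ d ≤ -t - 2 ∨
        d = -t - 1 ∨
        -t ≤ d ∧ d ≤ -1 ∨
        d = 0 ∨
        d = 1 ∨
        d = 2 ∨
        d = 3 ∨
        4 ≤ d ∧ d ≤ t + 3 ∨
        d = t + 4 ∨
        t + 5 ≤ d ∧ d ≤ 2 * t + 4 ∨
        d = 2 * t + 5 := by omega
    rcases h with h | rfl | h | rfl | rfl | rfl | rfl | h | rfl | h | rfl
    · exact (isLadder_two t).good_bottom_high c12 (by omega) (by omega)
    · exact (extra 2 rfl).rotate.rotate.good_of_eq (0) (by ring) c6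
    · exact (isLadder_two t).good_bottom_low c9 (by omega) (by omega)
    · exact (extra 8 rfl).good_of_eq (0) (by ring) c9
    · exact (extra 7 rfl).rotate.rotate.good_of_eq (0) (by ring) c3
    · exact (extra 5 rfl).rotate.rotate.good_of_eq (-1) (by ring) c22
    · exact (extra 6 rfl).rotate.rotate.good_of_eq (0) (by ring) c12
    · exact (isLadder_two t).good_top_low c12 (by omega) (by omega)
    · exact (extra 0 rfl).rotate.rotate.good_of_eq (-1) (by ring) c16
    · exact (isLadder_two t).good_top_high c9 (by omega) (by omega)
    · exact (extra 9 rfl).rotate.rotate.good_of_eq (-1) (by ring) c21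
  · have h : d = -(2 * t) - 2 ∨
        -(2 * t) - 1 ≤ d ∧ d ≤ -t - 2 ∨
        d = -t - 1 ∨
        d = -t ∨
        -t + 1 ≤ d ∧ d ≤ 0 ∨
        d = 1 ∨
        d = 2 ∨
        3 ≤ d ∧ d ≤ t + 2 ∨
        d = t + 3 ∨
        d = t + 4 ∨
        t + 5 ≤ d ∧ d ≤ 2 * t + 4 := by omega
    rcases h with rfl | h | rfl | rfl | h | rfl | rfl | h | rfl | rfl | h
    · exact (extra 14 rfl).rotate.rotate.good_of_eq (0) (by ring) c20
    · exact (isLadder_one t).good_outer_top_high c2 (by omega) (by omega)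
    · exact (extra 1 rfl).rotate.rotate.good_of_eq (0) (by ring) c23
    · exact vortex_good (.inr 2) (0) rfl (by ring) c1
    · exact (isLadder_one t).good_outer_top_low c2 (by omega) (by omega)
    · exact (extra 3 rfl).rotate.good_of_eq (0) (by ring) c11
    · exact (extra 12 rfl).rotate.rotate.good_of_eq (0) (by ring) c19
    · exact (isLadder_one t).good_outer_bottom_low c18 (by omega) (by omega)
    · exact (extra 4 rfl).rotate.good_of_eq (0) (by ring) c17
    · exact (extra 13 rfl).rotate.rotate.good_of_eq (-1) (by ring) c24
    · exact (isLadder_one t).good_outer_bottom_high c18 (by omega) (by omega)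
  · have h : d = -(2 * t) - 3 ∨
        d = -(2 * t) - 2 ∨
        -(2 * t) - 1 ≤ d ∧ d ≤ -2 ∨
        d = -1 ∨
        d = 0 ∨
        d = 1 ∨
        2 ≤ d ∧ d ≤ 2 * t + 1 ∨
        d = 2 * t + 2 ∨
        d = 2 * t + 3 := by omega
    rcases h with rfl | rfl | h | rfl | rfl | rfl | h | rfl | rfl
    · exact (extra 2 rfl).rotate.good_of_eq (1) (by ring) c14
    · exact (extra 11 rfl).rotate.good_of_eq (1) (by ring) c15
    · exact (isLadder_two t).good_rung c12 c9 (by omega)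
    · exact (extra 11 rfl).rotate.rotate.good_of_eq (-1) (by ring) c8
    · exact vortex_good (.inr 1) (0) rfl (by ring) c0
    · exact (extra 8 rfl).rotate.rotate.good_of_eq (0) (by ring) c4
    · exact (isLadder_two t).good_rung c12 c9 (by omega)
    · exact (extra 0 rfl).rotate.good_of_eq (0) (by ring) c7
    · exact (extra 11 rfl).good_of_eq (0) (by ring) c5

/-! ### Assembling the marked rotation and the theorem. -/

theorem exists_intCast_eq (t : ℕ) (x : ZMod (4 * t + 7)) (lo : ℤ) :
    ∃ d : ℤ, (d : ZMod (4 * t + 7)) = x ∧ lo ≤ d ∧ d ≤ lo + 4 * t + 6 := by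
  obtain ⟨y, rfl⟩ := ZMod.intCast_surjective x
  have hm : (0 : ℤ) < ((4 * t + 7 : ℕ) : ℤ) := by push_cast; omega
  refine ⟨lo + (y - lo) % ((4 * t + 7 : ℕ) : ℤ), ?_, ?_, ?_⟩
  · rw [Int.cast_add, ZMod.intCast_mod, ← Int.cast_add, add_sub_cancel]
  · have := Int.emod_nonneg (y - lo) hm.ne'
    omega
  · have := Int.emod_lt_of_pos (y - lo) hm
    push_cast at this ⊢
    omega

theorem exists_good (t : ℕ) (x : Fin 3 × ZMod (4 * t + 7) × Fin 3) :
    ∃ d : ℤ, reduce t (x.1, d, x.2.2) = x ∧ Good t x.1 d x.2.2 := by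
  have key : ∀ (i j : Fin 3) (lo hi : ℤ), hi = lo + 4 * t + 6 →
      (∀ d, lo ≤ d → d ≤ hi → Good t i d j) → ∀ x : ZMod (4 * t + 7),
        ∃ d : ℤ, reduce t (i, d, j) = (i, x, j) ∧ Good t i d j := by
    intro i j lo hi h hg x
    obtain ⟨d, rfl, h₁, h₂⟩ := exists_intCast_eq t x lo
    exact ⟨d, rfl, hg d h₁ (h ▸ h₂)⟩
  obtain ⟨i, x, j⟩ := x
  obtain ⟨h00, h01, h02⟩ := good_row_zero t
  obtain ⟨h10, h11, h12⟩ := good_row_one t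
  obtain ⟨h20, h21, h22⟩ := good_row_two t
  fin_cases i <;> fin_cases j
  · exact key 0 0 _ _ (by ring) h00 x
  · exact key 0 1 _ _ (by ring) h01 x
  · exact key 0 2 _ _ (by ring) h02 x
  · exact key 1 0 _ _ (by ring) h10 x
  · exact key 1 1 _ _ (by ring) h11 x
  · exact key 1 2 _ _ (by ring) h12 x
  · exact key 2 0 _ _ (by ring) h20 x
  · exact key 2 1 _ _ (by ring) h21 x
  · exact key 2 2 _ _ (by ring) h22 x

/-- 3(12t+19) + 6 = 9(4t+7). With this count, surjectivity alone shows that no arc lies on two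
faces. -/
theorem card_arcIndex (t : ℕ) :
    Fintype.card (ArcIndex t) = Fintype.card (Fin 3 × ZMod (4 * t + 7) × Fin 3) := by
  simp [ZMod.card]
  ring

/-- Every voltage arc and every mark occurs exactly once as a side of a face. -/
noncomputable def arcEquiv (t : ℕ) : ArcIndex t ≃ Fin 3 × ZMod (4 * t + 7) × Fin 3 :=
  Equiv.ofBijective (reduce t ∘ intArc t) ((Fintype.bijective_iff_surjective_and_card _).2
    ⟨fun x => by
      obtain ⟨d, h, hg, -⟩ := exists_good t x
      rwa [h] at hg, card_arcIndex t⟩)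

theorem arcEquiv_apply (t : ℕ) (e : ArcIndex t) : arcEquiv t e = reduce t (intArc t e) := rfl

/-- Face tracing on voltage arcs. -/
noncomputable def faceStep (t : ℕ) : Equiv.Perm (Fin 3 × ZMod (4 * t + 7) × Fin 3) :=
  (arcEquiv t).permCongr (turn t)

theorem faceStep_arcEquiv (t : ℕ) (e : ArcIndex t) :
    faceStep t (arcEquiv t e) = arcEquiv t (turn t e) := by
  simp [faceStep, Equiv.permCongr_apply]

theorem VoltageTriangle.exists_sides (T : VoltageTriangle) (r : Fin 3) :
    ∃ i a j b k, T.side r = (i, a, j) ∧ T.side (r + 1) = (j, b, k) ∧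
      T.side (r + 1 + 1) = (k, -(a + b), i) := by
  fin_cases r
  · exact ⟨_, _, _, _, _, rfl, rfl, rfl⟩
  · refine ⟨_, _, _, _, _, rfl, rfl, Prod.ext rfl (Prod.ext ?_ rfl)⟩
    change T.a = -(T.b + -(T.a + T.b))
    ring
  · refine ⟨_, _, _, _, _, rfl, rfl, Prod.ext rfl (Prod.ext ?_ rfl)⟩
    change T.b = -(-(T.a + T.b) + T.a)
    ring

theorem sameCycle_of_eqvGen {t : ℕ} {x y : Fin 3 × ZMod (4 * t + 7) × Fin 3}
    (h : Relation.EqvGen (RotStep t) x y) :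
    Equiv.Perm.SameCycle ((voltageRev _ _).trans (faceStep t)) x y := by
  induction h with
  | rel x y h =>
    obtain ⟨e, h1, h2⟩ := h
    refine ⟨1, ?_⟩
    rw [zpow_one, Equiv.trans_apply, ← h1, ← arcEquiv_apply, faceStep_arcEquiv, arcEquiv_apply, h2]
  | refl x => exact .refl _ _
  | symm x y _ ih => exact ih.symm
  | trans x y z _ _ ih1 ih2 => exact ih1.trans ih2

theorem arcEquiv_mark (t : ℕ) (j : Fin 3) : ∃ e, arcEquiv t (.inr e) = (j, 0, j) := by
  fin_cases j
  · exact ⟨.inl 1, by simp [arcEquiv_apply, intArc, reduce]⟩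
  · exact ⟨.inr 3, by simp [arcEquiv_apply, intArc, reduce]⟩
  · exact ⟨.inr 1, by simp [arcEquiv_apply, intArc, reduce]⟩

/-- On the faces with marks, arcs and marks alternate. -/
theorem vortex_arc_or_mark (t : ℕ) (e : Fin 2 ⊕ Fin 4) :
    (∃ j, arcEquiv t (.inr e) = (j, 0, j)) ∨
      (∃ j, arcEquiv t (turn t (.inr e)) = (j, 0, j)) ∧
        ∃ e', arcEquiv t (.inr e') = ((arcEquiv t (.inr e)).1, 0, (arcEquiv t (.inr e)).1) ∧
          turn t (.inr e') = .inr e := by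
  have hm : ∀ (e : Fin 2 ⊕ Fin 4) (j : Fin 3), intArc t (.inr e) = (j, 0, j) →
      arcEquiv t (.inr e) = (j, 0, j) := by
    intro e j h
    rw [arcEquiv_apply, h]
    simp [reduce]
  rcases e with e | e <;> fin_cases e
  · exact .inr ⟨⟨0, hm (.inl 1) 0 rfl⟩, .inl 1, hm (.inl 1) 0 rfl, rfl⟩
  · exact .inl ⟨0, hm (.inl 1) 0 rfl⟩
  · exact .inr ⟨⟨2, hm (.inr 1) 2 rfl⟩, .inr 3, hm (.inr 3) 1 rfl, rfl⟩
  · exact .inl ⟨2, hm (.inr 1) 2 rfl⟩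
  · exact .inr ⟨⟨1, hm (.inr 3) 1 rfl⟩, .inr 1, hm (.inr 1) 2 rfl, rfl⟩
  · exact .inl ⟨1, hm (.inr 3) 1 rfl⟩

theorem eq_mark_of_eq {t : ℕ} {i j k : Fin 3} {d : ZMod (4 * t + 7)}
    (h : (k, (0 : ZMod (4 * t + 7)), k) = (i, d, j)) : (i, d, j) = (i, 0, i) := by
  simp only [Prod.mk.injEq] at h
  obtain ⟨rfl, rfl, rfl⟩ := h
  rfl

/-- The translation invariant faces of a marked rotation of `K_{12 t + 21}`. -/
noncomputable def voltageFaces (t : ℕ) : VoltageFaces (ZMod (4 * t + 7)) (Fin 3) where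
  face := faceStep t
  fst_face x := by
    obtain ⟨e | e | e, rfl⟩ := (arcEquiv t).surjective x
    · obtain ⟨i, a, j, b, k, h1, h2, -⟩ := (triangleOf t e.1).exists_sides e.2
      rw [faceStep_arcEquiv]
      change (reduce t ((triangleOf t e.1).side (e.2 + 1))).1
        = (reduce t ((triangleOf t e.1).side e.2)).2.2
      rw [h1, h2]
      rfl
    · rw [faceStep_arcEquiv]
      fin_cases e <;> rfl
    · rw [faceStep_arcEquiv]
      fin_cases e <;> rfl
  sameCycle x := by
    obtain ⟨d, h, -, hc⟩ := exists_good t x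
    have := sameCycle_of_eqvGen hc
    have h0 : reduce t (x.1, 0, x.1) = (x.1, 0, x.1) := by simp [reduce]
    rwa [h, h0] at this
  triangle i d j e k h1 h2 h := by
    obtain ⟨x, hx⟩ := (arcEquiv t).surjective (i, d, j)
    have hy := h
    rw [← hx, faceStep_arcEquiv] at hy
    rw [← hy, faceStep_arcEquiv]
    rcases x with x | x
    · obtain ⟨i', a, j', b, k', h1, h2, h3⟩ := (triangleOf t x.1).exists_sides x.2
      change reduce t ((triangleOf t x.1).side x.2) = _ at hx
      change reduce t ((triangleOf t x.1).side (x.2 + 1)) = _ at hy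
      change reduce t ((triangleOf t x.1).side (x.2 + 1 + 1)) = _
      rw [h1] at hx
      rw [h2] at hy
      rw [h3]
      simp only [reduce, Prod.mk.injEq] at hx hy ⊢
      obtain ⟨rfl, rfl, rfl⟩ := hx
      obtain ⟨-, rfl, rfl⟩ := hy
      simp
    -- On a marked face one of two consecutive entries is a mark, contrary to `h1` or `h2`.
    · rcases vortex_arc_or_mark t x with ⟨k', hk⟩ | ⟨⟨k', hk⟩, -⟩
      · exact absurd (eq_mark_of_eq (hk.symm.trans hx)) h1
      · exact absurd (eq_mark_of_eq (hk.symm.trans hy)) h2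
  marked i d j h1 h := by
    obtain ⟨x, hx⟩ := (arcEquiv t).surjective (i, d, j)
    have hy := h
    rw [← hx, faceStep_arcEquiv] at hy
    rcases x with x | x
    -- A side of a triangle is never followed by a mark, because `turn` preserves the two kinds of
    -- faces.
    · obtain ⟨e, he⟩ := arcEquiv_mark t j
      have := (arcEquiv t).injective (hy.trans he.symm)
      simp [turn] at this
    · rcases vortex_arc_or_mark t x with ⟨k', hk⟩ | ⟨-, e, he, hturn⟩
      · exact absurd (eq_mark_of_eq (hk.symm.trans hx)) h1
      · rw [hx] at he
        rw [← he, faceStep_arcEquiv, hturn, hx]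

theorem mainTheorem4 (s : ℕ) (hs : 1 ≤ s) :
    (∃ R : RotationSystem (prism (12 * s + 9)), IsSnug R) ∧
    (∃ g : ℕ, IsGraphGenus (prism (12 * s + 9)) g ∧
      (g : ℚ) = (((12 * s + 9 : ℕ) : ℚ) - 2) * (((12 * s + 9 : ℕ) : ℚ) - 3) / 6) := by
  obtain ⟨t, rfl⟩ : ∃ t, s = t + 1 := ⟨s - 1, by omega⟩
  have e : ZMod (4 * t + 7) × Fin 3 ≃ Fin (12 * (t + 1) + 9) :=
    Fintype.equivFinOfCardEq (by simp [ZMod.card]; ring)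
  have hR := ((voltageFaces t).lift.map e).isSnug_prismRotation (by omega)
  -- With n = 12t + 21: n - 2 = 12t + 19 and n - 3 = 6(2t + 3).
  refine ⟨⟨_, hR⟩, (12 * t + 19) * (2 * t + 3), hR.isGraphGenus (by omega) ?_, ?_⟩
  · push_cast
    ring
  · push_cast
    ring
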